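/- **Setting.** *Transformers.* A unique hard attention transformer (UHAT) over a token set has a width $d$, a head dimension $m$, a context window, token embeddings and arbitrary positional embeddings in $\mathbb R^d$ (which are added), and finitely many layers. A layer maps $X\in\mathbb R^{n\times d}$ to $\psi([\mathrm{Att}_1(X),\dots,\mathrm{Att}_H(X)]W_O)$, where $\psi:\mathbb R^d\to\mathbb R^d$ is an arbitrary function applied to each row, $W_O\in\mathbb R^{mH\times d}$, and $\mathrm{Att}_h(X)=\mathrm{UHAT}(XW_QW_K^\top X^\top)\,XW_V$ with $W_Q,W_K,W_V\in\mathbb R^{d\times m}$ depending on $h$. Here row $i$ of $\mathrm{UHAT}(S)$ has the entry $1$ at the rightmost $j\le i$ that maximises $S_{ij}$ over all $j\le i$, and $0$ elsewhere. The next token is a function of the last row of the last layer's output. *Multi-agent systems.* Let $M$ be a finite set and $\Xi\supseteq M$, with finite sets $M\subseteq\Xi_1\subseteq\Xi_2\subseteq\dots\subseteq\Xi$ of size polynomial in the index. A multi-agent system $\mathcal A$ with $w(N)\in\{1,\dots,N\}$ agents on inputs of length $N\ge1$, one of which (depending only on $N$) is the manager, assigns to each $x\in M^N$ a labelled directed acyclic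 graph $\mathcal A(x)$. Its nodes are $T_i^{(t)}$, $1\le i\le w(N)$, $1\le t\le D_i$. Its edges, labelled by elements of $\Xi_N$, are chain-of-thought (CoT) edges from $T_i^{(t)}$ to $T_i^{(t+1)}$ and communication edges from $T_i^{(t)}$ to $T_j^{(t+1)}$ with $j\ne i$. Every node with $t>1$ has exactly one incoming edge. Every node has no outgoing edge, or exactly one, or communication edges with one common label to all other agents (a broadcast). The system *computes* $f:\bigcup_{N\ge1}M^N\to M$ if for every $x$ the last CoT edge of the manager in $\mathcal A(x)$ exists and has the label $f(x)$. The string of agent $i$ consists of the contiguous chunk of the letters of $x$ with positions in $(\lceil N(i-1)/w(N)\rceil,\lceil Ni/w(N)\rceil]$, a token for the identity $i$, then for each node $T_i^{(1)},T_i^{(2)},\dots$ of the agent a token $\mathsf{RECEIVE}_\sigma$ if there is an incoming communication edge with label $\sigma$, followed by $\sigma$, $\mathsf{SEND}_{\sigma,j}$ or $\mathsf{BROADCAST}_\sigma$ if there is an outgoing CoT edge, communication edge to $j$, or broadcast, respectively, with label $\sigma$; and finally a token $\mathsf{EOS}$. A UHAT implements $\mathcal A$ on $x$ if these strings fit into its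 context window, it predicts every token arising from outgoing edges and every $\mathsf{EOS}$ from the tokens before it, and at a node without outgoing edge it does not predict a $\mathsf{SEND}$ or $\mathsf{BROADCAST}$ token (an incoming message may override another prediction, but a generated message is always sent). All multi-agent systems are assumed to be computed by UHATs: for each $n$ there is a single UHAT, used by all agents, that implements $\mathcal A$ on all inputs of length at most $n$, and the numbers of layers and of heads are bounded uniformly in $n$ (the width need not be). *Complexity.* The depth of $\mathcal A(x)$ is the length (number of edges) of its longest path, and $\mathrm{Depth}(N)$ is its maximum over all inputs of length at most $N$. The communication budget of $\mathcal A(x)$ is the number of nodes with an outgoing communication edge, and $\mathrm{Comm}(N)$ is its maximum over all inputs of length $N$. **Proposition (Optimality).** Let $M$ be a nontrivial finite group, and let $\mathcal A$ be a multi-agent system, computed by UHATs, that computes state tracking over $M$, that is, the function $m_1m_2\cdots m_N\mapsto m_1\cdot m_2\cdots m_N$. Then $\mathcal A$ has communication budget $\Omega(w(N))$ (over the lengths with at least two agents) and computation depth $\Omega(N/w(N))$: there is a constant $c>0$, which may depend on $\mathcal A$, such that for all $N\ge1$ $$\mathrm{Comm}(N)\ \ge\ c\,w(N)\quad\text{whenever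 } w(N)\ge2,\qquad\text{and}\qquad \mathrm{Depth}(N)\ \ge\ c\,\frac{N}{w(N)} .$$ -/

import Mathlib

noncomputable section

open scoped Classical

/-! Unique hard attention transformers. -/

/-- Causally masked unique hard attention: row `i` puts weight `1` on the rightmost position
`j ≤ i` that maximises the score `S i j` among the positions `≤ i`, and weight `0` elsewhere. -/
def hardAttention {n : ℕ} (S : Matrix (Fin n) (Fin n) ℝ) : Matrix (Fin n) (Fin n) ℝ :=
  Matrix.of fun i j =>
    if j ≤ i ∧ (∀ k ≤ i, S i k ≤ S i j) ∧ (∀ k ≤ i, j < k → S i k < S i j) then 1 else 0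

/-- One transformer layer of width `d` and head dimension `m`: a multi-head hard attention block,
followed by a position-wise map `mlp` (any function is admitted). -/
structure UHATLayer (d m : ℕ) where
  heads : ℕ
  WQ : Fin heads → Matrix (Fin d) (Fin m) ℝ
  WK : Fin heads → Matrix (Fin d) (Fin m) ℝ
  WV : Fin heads → Matrix (Fin d) (Fin m) ℝ
  WO : Matrix (Fin heads × Fin m) (Fin d) ℝ
  mlp : (Fin d → ℝ) → (Fin d → ℝ)

namespace UHATLayer

variable {d m n : ℕ}

/-- The output of a single attention head. -/
def head (l : UHATLayer d m) (X : Matrix (Fin n) (Fin d) ℝ) (h : Fin l.heads) :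
    Matrix (Fin n) (Fin m) ℝ :=
  hardAttention (X * l.WQ h * (l.WK h).transpose * X.transpose) * (X * l.WV h)

/-- Multi-head attention: the concatenation of the heads, multiplied by `WO`. -/
def multiHead (l : UHATLayer d m) (X : Matrix (Fin n) (Fin d) ℝ) : Matrix (Fin n) (Fin d) ℝ :=
  (Matrix.of fun i (p : Fin l.heads × Fin m) => l.head X p.1 i p.2) * l.WO

/-- The output of the layer. -/
def apply (l : UHATLayer d m) (X : Matrix (Fin n) (Fin d) ℝ) : Matrix (Fin n) (Fin d) ℝ :=
  Matrix.of fun i => l.mlp (l.multiHead X i)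

end UHATLayer

/-- A unique hard attention transformer over the token type `α`, with context window `maxLen`,
token embeddings, arbitrary positional embeddings (positions are counted from `0`), a list of
layers, and a decoding map from the final activation to the next token (any function is admitted,
for instance greedy decoding of an unembedding matrix). -/
structure UHAT (α : Type*) where
  d : ℕ
  m : ℕ
  maxLen : ℕ
  embed : α → Fin d → ℝ
  pos : ℕ → Fin d → ℝ
  layers : List (UHATLayer d m)
  decode : (Fin d → ℝ) → α

namespace UHAT

variable {α : Type*}

/-- The activations of the last layer on the token string `s`. -/
def run (T : UHAT α) (s : List α) : Matrix (Fin s.length) (Fin T.d) ℝ :=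
  T.layers.foldl (fun X l => l.apply X) (Matrix.of fun i => T.embed (s.get i) + T.pos i)

/-- `a` is the token that the transformer predicts after the (nonempty) string `s`. -/
def Predicts (T : UHAT α) (s : List α) (a : α) : Prop :=
  ∃ i : Fin s.length, (i : ℕ) + 1 = s.length ∧ T.decode (T.run s i) = a

end UHAT

/-! Communication graphs. -/

/-- The outgoing edges of a node: no edge, a chain-of-thought edge with a label, a communication
edge with a label to one agent, or communication edges with one label to all other agents. -/
inductive AgentAction (Ξ : Type*) (w : ℕ) where
  | none : AgentAction Ξ w
  | cot (σ : Ξ) : AgentAction Ξ w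
  | send (σ : Ξ) (j : Fin w) : AgentAction Ξ w
  | bcast (σ : Ξ) : AgentAction Ξ w

/-- A labelled communication graph with `w` agents. Agent `i` has the nodes `(i, t)`, `t < len i`
(times are counted from `0`); `act i t` describes the edges that leave `(i, t)`. -/
structure CommGraph (Ξ : Type*) (w : ℕ) where
  len : Fin w → ℕ
  act : Fin w → ℕ → AgentAction Ξ w

namespace CommGraph

variable {Ξ : Type*} {w : ℕ}

/-- The label of the communication edge from `(i, t)` to `(j, t + 1)`, if there is one. -/
def msg (G : CommGraph Ξ w) (i : Fin w) (t : ℕ) (j : Fin w) : Option Ξ :=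
  if i = j then none else
    match G.act i t with
    | .send σ k => if k = j then some σ else none
    | .bcast σ => some σ
    | _ => none

/-- There is a chain-of-thought edge from `(i, t)` to `(i, t + 1)`. -/
def HasCot (G : CommGraph Ξ w) (i : Fin w) (t : ℕ) : Prop := ∃ σ, G.act i t = .cot σ

/-- There is an edge, of either type, from `u` to `v`. -/
def Edge (G : CommGraph Ξ w) (u v : Fin w × ℕ) : Prop :=
  v.2 = u.2 + 1 ∧ ((u.1 = v.1 ∧ G.HasCot u.1 u.2) ∨ ∃ σ, G.msg u.1 u.2 v.1 = some σ)

/-- The conditions on a communication graph with labels in `Λ`: edges join nodes, agents do not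
send messages to themselves, every node of positive time has exactly one incoming edge. -/
structure WellFormed (G : CommGraph Ξ w) (Λ : Finset Ξ) : Prop where
  act_eq_none : ∀ i t, G.len i ≤ t → G.act i t = .none
  edge_node : ∀ i t j, G.Edge (i, t) (j, t + 1) → t + 1 < G.len j
  cot_mem : ∀ i t σ, G.act i t = .cot σ → σ ∈ Λ
  send_mem : ∀ i t σ j, G.act i t = .send σ j → σ ∈ Λ ∧ j ≠ i
  bcast_mem : ∀ i t σ, G.act i t = .bcast σ → σ ∈ Λ ∧ ∃ j, j ≠ i
  unique_incoming : ∀ j t, t + 1 < G.len j → ∃! i, G.Edge (i, t) (j, t + 1)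

/-- Computation depth: the length (number of edges) of a longest path. -/
def depth (G : CommGraph Ξ w) : ℕ :=
  sSup {k | ∃ p : RelSeries {e : (Fin w × ℕ) × (Fin w × ℕ) | G.Edge e.1 e.2}, p.length = k}

/-- Communication budget: the number of nodes with an outgoing communication edge. -/
def commBudget (G : CommGraph Ξ w) : ℕ :=
  Set.ncard {v : Fin w × ℕ | ∃ j σ, G.msg v.1 v.2 j = some σ}

/-- The last chain-of-thought edge of agent `i` exists and has the label `σ`. -/
def LastCot (G : CommGraph Ξ w) (i : Fin w) (σ : Ξ) : Prop :=
  ∃ t, G.act i t = .cot σ ∧ ∀ s, t < s → ¬ G.HasCot i s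

end CommGraph

/-! The token strings processed by the agents. -/

/-- Tokens: plain symbols (input and chain of thought), agent identifiers, received messages, sent
messages (with the receiver), broadcast messages, and the end of the sequence. -/
inductive Token (Ξ : Type*) where
  | sym (σ : Ξ) : Token Ξ
  | ident (i : ℕ) : Token Ξ
  | recv (σ : Ξ) : Token Ξ
  | send (σ : Ξ) (j : ℕ) : Token Ξ
  | bcast (σ : Ξ) : Token Ξ
  | eos : Token Ξ

/-- The token is an instruction to send or broadcast a message. -/
def Token.IsMessage {Ξ : Type*} : Token Ξ → Prop
  | .send _ _ => True
  | .bcast _ => True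
  | _ => False

/-- The part of the word `x` that agent `i` of `w` agents (counted from `0`) receives: the letters
with (zero-based) positions from `⌈N i / w⌉` to `⌈N (i + 1) / w⌉ - 1`. -/
def chunk {M : Type*} {N : ℕ} (x : Fin N → M) (w i : ℕ) : List M :=
  ((List.ofFn x).take ((N * (i + 1)) ⌈/⌉ w)).drop ((N * i) ⌈/⌉ w)

namespace CommGraph

variable {Ξ : Type*} {w : ℕ}

/-- The token for an incoming communication edge at the node `(j, t)`, if there is one. -/
def recvTokens (G : CommGraph Ξ w) (j : Fin w) : ℕ → List (Token Ξ)
  | 0 => []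
  | t + 1 => ((List.finRange w).filterMap fun i => G.msg i t j).map Token.recv

/-- The token for the outgoing edges at the node `(i, t)`, if there are any. -/
def outTokens (G : CommGraph Ξ w) (i : Fin w) (t : ℕ) : List (Token Ξ) :=
  match G.act i t with
  | .none => []
  | .cot σ => [Token.sym σ]
  | .send σ j => [Token.send σ j]
  | .bcast σ => [Token.bcast σ]

/-- The string of agent `i` whose input chunk is `c`, up to and including the nodes of times
`0, …, t - 1`. -/
def history (G : CommGraph Ξ w) (c : List Ξ) (i : Fin w) (t : ℕ) : List (Token Ξ) :=
  c.map Token.sym ++ [Token.ident i] ++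
    (List.range t).flatMap fun s => G.recvTokens i s ++ G.outTokens i s

/-- The string from which the token of the outgoing edge of `(i, t)` has to be predicted. -/
def contextAt (G : CommGraph Ξ w) (c : List Ξ) (i : Fin w) (t : ℕ) : List (Token Ξ) :=
  G.history c i t ++ G.recvTokens i t

/-- The full string processed by agent `i`. -/
def fullString (G : CommGraph Ξ w) (c : List Ξ) (i : Fin w) : List (Token Ξ) :=
  G.history c i (G.len i) ++ [Token.eos]

/-- The transformer `T` implements the graph `G` on the input chunks `c`: all strings fit into the
context window, and the transformer predicts all tokens of outgoing edges and the final `eos`.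
In a step in which an agent emits nothing because an incoming message overrides it, what is
overridden must not be a message: a message that the transformer generates is sent. -/
structure ImplementedBy (G : CommGraph Ξ w) (c : Fin w → List Ξ) (T : UHAT (Token Ξ)) : Prop where
  fits : ∀ i, (G.fullString (c i) i).length ≤ T.maxLen
  predicts_out : ∀ i t, t < G.len i → ∀ a ∈ G.outTokens i t, T.Predicts (G.contextAt (c i) i t) a
  predicts_eos : ∀ i, T.Predicts (G.history (c i) i (G.len i)) Token.eos
  sends_messages : ∀ i t, t < G.len i → G.act i t = .none →
    ∀ a, T.Predicts (G.contextAt (c i) i t) a → ¬ a.IsMessage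

end CommGraph

/-! Multi-agent systems. -/

/-- A multi-agent system with input alphabet `M` and chain-of-thought alphabet `Ξ ⊇ M`. For inputs
of length `N ≥ 1` there are `w N ∈ {1, …, N}` agents, one of which is the manager, and labels are
taken from a finite alphabet `alphabet N ⊇ M` of size polynomial in `N`. -/
structure MultiAgentSystem (M Ξ : Type*) where
  incl : M ↪ Ξ
  alphabet : ℕ → Finset Ξ
  alphabet_mono : Monotone alphabet
  incl_mem : ∀ N, 1 ≤ N → ∀ a, incl a ∈ alphabet N
  alphabet_poly : ∃ C k : ℕ, ∀ N, 1 ≤ N → (alphabet N).card ≤ C * N ^ k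
  w : ℕ → ℕ
  w_pos : ∀ N, 1 ≤ N → 1 ≤ w N
  w_le : ∀ N, 1 ≤ N → w N ≤ N
  manager : ∀ N, 1 ≤ N → Fin (w N)
  graph : ∀ N, (Fin N → M) → CommGraph Ξ (w N)
  wellFormed : ∀ N, 1 ≤ N → ∀ x, (graph N x).WellFormed (alphabet N)

namespace MultiAgentSystem

variable {M Ξ : Type*}

/-- The system computes `f`: on each nonempty input, the label of the last chain-of-thought edge of
the manager is the value of `f`. -/
def Computes (A : MultiAgentSystem M Ξ) (f : List M → M) : Prop :=
  ∀ N (hN : 1 ≤ N) (x : Fin N → M),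
    (A.graph N x).LastCot (A.manager N hN) (A.incl (f (List.ofFn x)))

/-- The system is computed by hard attention transformers: for each `n` there is one transformer
that implements the system on all inputs of length at most `n`, and the numbers of layers and of
heads are bounded uniformly in `n`. -/
def ExpressibleInUHAT (A : MultiAgentSystem M Ξ) : Prop :=
  ∃ (L H : ℕ) (T : ℕ → UHAT (Token Ξ)),
    (∀ n, (T n).layers.length ≤ L ∧ ∀ l ∈ (T n).layers, l.heads ≤ H) ∧
    ∀ n N, 1 ≤ N → N ≤ n → ∀ x : Fin N → M,
      (A.graph N x).ImplementedBy (fun i => (chunk x (A.w N) i).map A.incl) (T n)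

/-- The maximal computation depth on inputs of length at most `N`. -/
def depth [Fintype M] (A : MultiAgentSystem M Ξ) (N : ℕ) : ℕ :=
  (Finset.Icc 1 N).sup fun n => Finset.univ.sup fun x : Fin n → M => (A.graph n x).depth

/-- The maximal communication budget on inputs of length `N`. -/
def commBudget [Fintype M] (A : MultiAgentSystem M Ξ) (N : ℕ) : ℕ :=
  Finset.univ.sup fun x : Fin N → M => (A.graph N x).commBudget

end MultiAgentSystem

/-- The state tracking problem over a monoid: the product of a word. -/
def stateTracking (M : Type*) [Monoid M] : List M → M := List.prod

end

/-!
Both bounds come from the sensitivity of a product in a group: changing a single letter changes it.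
They use that the agents are deterministic (`CommGraph.AgreeBefore.succ`): if the pasts of two runs
agree and the transformer predicts the same tokens, then the agents act in the same way. The one
delicate point is that an incoming message may override a predicted token, but the messages
themselves are determined by the predictions.

*Communication.* If an agent other than the manager sends nothing on a word, nor on the word that
differs from it in one letter of the chunk of this agent, then all other agents behave identically
on both words, so the manager gives the same answer, which is wrong for one of them
(`MultiAgentSystem.sends_or_sends`). Multiplying that letter by a fixed `g ≠ 1` is a bijection on
words, so the agent sends a message on at least half of all words; averaging over the words, some
word makes at least half of these agents send a message.

*Depth.* Every node of positive time has a predecessor, so each agent has at most one more node than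
the depth `D`, and the first agent, with a chunk of `n ≥ N / w` letters, processes `O(D)` tokens
after its input. It is shown that `n` is `O(D)`. The transformer is fooled in two steps, in which
letters are fixed and the remaining words form a subcube.

The first step (`exists_cube_allSingle`) leaves a positive proportion of the letters free and makes
every activation of every layer at the input positions depend on at most one free letter. It goes
layer by layer. A query is a head at some position together with a value of the letter on which the
activation there depends. It is captured by a set `T` of letters if the position attended to never
depends on a free letter outside `T`. An uncaptured query has many letters each of which captures it
when fixed to a suitable value: going down the scores, take the largest one, then the largest one
that concerns a new letter, and so on. As the number of queries is linear in the number of free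
letters, by pigeonhole one letter captures many queries at once, and few fixed letters capture all
of them (`exists_cube_captured`). Then all outputs depend on boundedly many letters, and a large
independent set of letters (`exists_independent`) reduces this to one letter.

The second step (`exists_cube_frozen`, `MultiAgentSystem.exists_cube_agreeBefore`) follows the
computation token by token. At a new position, the current activation is already constant, so for
each head the best key over all remaining words can be realised by fixing one letter, which makes
the head, and finally the prediction, constant. The cost is one letter per token, layer and head.
If a free letter were left in the end, two words with different products would give the same graph.
-/

/-! ### Rightmost maximisers -/

open scoped Classical in
/-- The rightmost position `k ≤ i` at which the score `φ` is maximal among the positions `≤ i`. -/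
noncomputable def leader (φ : ℕ → ℝ) : ℕ → ℕ
  | 0 => 0
  | i + 1 => if φ (leader φ i) ≤ φ (i + 1) then i + 1 else leader φ i

/-- The priority of a position: its score, with ties broken in favour of larger positions. -/
abbrev prio (φ : ℕ → ℝ) (k : ℕ) : ℝ ×ₗ ℕ := toLex (φ k, k)

theorem leader_le (φ : ℕ → ℝ) (i : ℕ) : leader φ i ≤ i := by
  induction i with
  | zero => simp [leader]
  | succ i ih => rw [leader]; split_ifs <;> omega

theorem prio_le_prio_leader (φ : ℕ → ℝ) {i k : ℕ} (hk : k ≤ i) :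
    prio φ k ≤ prio φ (leader φ i) := by
  induction i generalizing k with
  | zero => obtain rfl : k = 0 := by omega
            simp [leader]
  | succ i ih =>
    have h1 := leader_le φ i
    rw [leader]
    split_ifs with h
    · rcases Nat.lt_or_ge k (i + 1) with hk' | hk'
      · refine (ih (by omega : k ≤ i)).trans ?_
        rw [prio, prio, Prod.Lex.toLex_le_toLex]
        rcases h.lt_or_eq with h | h
        · exact Or.inl h
        · exact Or.inr ⟨h, by simp; omega⟩
      · obtain rfl : k = i + 1 := by omega
        exact le_rfl
    · rcases Nat.lt_or_ge k (i + 1) with hk' | hk'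
      · exact ih (by omega)
      · obtain rfl : k = i + 1 := by omega
        rw [prio, prio, Prod.Lex.toLex_le_toLex]
        exact Or.inl (not_le.1 h)

theorem prio_injective (φ : ℕ → ℝ) : Function.Injective (prio φ) := by
  intro a b h
  simpa using congrArg (fun z => (ofLex z).2) h

theorem leader_eq_of_forall_prio_le {φ : ℕ → ℝ} {i k : ℕ} (hk : k ≤ i)
    (h : ∀ j ≤ i, prio φ j ≤ prio φ k) : leader φ i = k :=
  prio_injective φ (le_antisymm (h _ (leader_le φ i)) (prio_le_prio_leader φ hk))

theorem leader_congr {φ φ' : ℕ → ℝ} {i : ℕ} (h : ∀ k ≤ i, φ k = φ' k) :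
    leader φ i = leader φ' i := by
  have h' : ∀ k ≤ i, prio φ k = prio φ' k := fun k hk => by rw [prio, prio, h k hk]
  refine leader_eq_of_forall_prio_le (leader_le _ _) fun j hj => ?_
  rw [h' j hj, h' _ (leader_le _ _)]
  exact prio_le_prio_leader φ' hj

/-! ### Subcubes and functions of few letters -/

section Cube

variable {ι M β γ : Type*}

/-- The words that agree with `y` at all positions outside `F`: the positions in `F` are free, the
other ones are fixed. -/
def cube (F : Finset ι) (y : ι → M) : Set (ι → M) := {x | ∀ i, i ∉ F → x i = y i}

theorem base_mem_cube (F : Finset ι) (y : ι → M) : y ∈ cube F y := fun _ _ => rfl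

theorem cube_subset_cube {F F' : Finset ι} {y y' : ι → M} (hF : F' ⊆ F) (hy : y' ∈ cube F y) :
    cube F' y' ⊆ cube F y :=
  fun _ hx i hi => (hx i fun h => hi (hF h)).trans (hy i hi)

theorem eq_of_mem_cube {F : Finset ι} {y x x' : ι → M} (hx : x ∈ cube F y) (hx' : x' ∈ cube F y)
    {i : ι} (hi : i ∉ F) : x i = x' i :=
  (hx i hi).trans (hx' i hi).symm

theorem update_mem_cube [DecidableEq ι] {F : Finset ι} {y x : ι → M} (hx : x ∈ cube F y) {i : ι}
    (hi : i ∈ F) (a : M) : Function.update x i a ∈ cube F y := by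
  intro j hj
  rw [Function.update_of_ne (by rintro rfl; exact hj hi)]
  exact hx j hj

/-- On the set `C` of words, `f` is a function of the letters at the positions in `S`. -/
def DeterminedBy (C : Set (ι → M)) (S : Finset ι) (f : (ι → M) → β) : Prop :=
  ∀ x ∈ C, ∀ x' ∈ C, (∀ i ∈ S, x i = x' i) → f x = f x'

theorem DeterminedBy.mono {C C' : Set (ι → M)} {S S' : Finset ι} {f : (ι → M) → β}
    (h : DeterminedBy C S f) (hC : C' ⊆ C) (hS : S ⊆ S') : DeterminedBy C' S' f :=
  fun x hx x' hx' hxx => h x (hC hx) x' (hC hx') fun i hi => hxx i (hS hi)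

theorem DeterminedBy.congr {C : Set (ι → M)} {S : Finset ι} {f g : (ι → M) → β}
    (h : DeterminedBy C S f) (hfg : ∀ x ∈ C, f x = g x) : DeterminedBy C S g :=
  fun x hx x' hx' hxx => by rw [← hfg x hx, ← hfg x' hx', h x hx x' hx' hxx]

theorem DeterminedBy.comp {C : Set (ι → M)} {S : Finset ι} {f : (ι → M) → β}
    (h : DeterminedBy C S f) (g : β → γ) : DeterminedBy C S fun x => g (f x) :=
  fun x hx x' hx' hxx => congrArg g (h x hx x' hx' hxx)

theorem DeterminedBy.of_filter {F S : Finset ι} {y : ι → M} {f : (ι → M) → β}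
    [DecidablePred (· ∈ F)] (h : DeterminedBy (cube F y) S f) :
    DeterminedBy (cube F y) (S.filter (· ∈ F)) f := by
  intro x hx x' hx' hxx
  refine h x hx x' hx' fun i hi => ?_
  by_cases hiF : i ∈ F
  · exact hxx i (Finset.mem_filter.2 ⟨hi, hiF⟩)
  · exact eq_of_mem_cube hx hx' hiF

/-- Suppose that the score of each position `k` depends on the letter `v k` only. Take the position
`k₀` in `R` and the word `x₀` in `C` for which the priority is largest. On all words of `C` with
the same letter at `v k₀` as `x₀`, the position `k₀` then beats all positions in `R`. -/
theorem exists_dominant [Finite ι] [Finite M] {C : Set (ι → M)} (hC : C.Nonempty) {v : ℕ → ι}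
    {φ : (ι → M) → ℕ → ℝ} {p : ℕ} (hφ : ∀ k ≤ p, DeterminedBy C {v k} fun x => φ x k)
    (R : ℕ → Prop) (hR : ∃ k ≤ p, R k) :
    ∃ k₀ ≤ p, R k₀ ∧ ∃ x₀ ∈ C, ∀ x ∈ C, x (v k₀) = x₀ (v k₀) →
      ∀ k ≤ p, R k → prio (φ x) k ≤ prio (φ x) k₀ := by
  have hfin : ({k | k ≤ p ∧ R k} ×ˢ C).Finite :=
    ((Set.finite_Iic p).subset fun k hk => hk.1).prod (Set.toFinite C)
  obtain ⟨k₁, hk₁, hRk₁⟩ := hR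
  obtain ⟨x₁, hx₁⟩ := hC
  obtain ⟨⟨k₀, x₀⟩, ⟨⟨hk₀, hRk₀⟩, hx₀⟩, hmax⟩ := Set.exists_max_image _
    (fun z : ℕ × (ι → M) => prio (φ z.2) z.1) hfin ⟨(k₁, x₁), ⟨hk₁, hRk₁⟩, hx₁⟩
  refine ⟨k₀, hk₀, hRk₀, x₀, hx₀, fun x hx hxx k hk hRk => ?_⟩
  have h1 := hmax (k, x) ⟨⟨hk, hRk⟩, hx⟩
  have h2 : φ x k₀ = φ x₀ k₀ := hφ k₀ hk₀ x hx x₀ hx₀ (by simpa using hxx)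
  simpa only [prio, h2] using h1

/-! ### Capturing a query -/

/-- The variable that the leading position at `p` reads, if free, always lies in `T`. -/
def Captured (F : Finset ι) (y : ι → M) (v : ℕ → ι) (φ : (ι → M) → ℕ → ℝ) (p : ℕ)
    (T : Finset ι) : Prop :=
  ∀ x ∈ cube F y, v (leader (φ x) p) ∈ F → v (leader (φ x) p) ∈ T

theorem Captured.mono {F F' T : Finset ι} {y y' : ι → M} {v : ℕ → ι} {φ : (ι → M) → ℕ → ℝ} {p : ℕ}
    (h : Captured F y v φ p T) (hF : F' ⊆ F) (hy : y' ∈ cube F y) : Captured F' y' v φ p T :=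
  fun x hx hv => h x (cube_subset_cube hF hy hx) (hF hv)

variable [DecidableEq ι]

/-- If `T` does not capture a query, then one more letter `w` can be read off from the best position
that concerns a letter outside `T`; once `w` has the value `b`, all other letters are irrelevant. -/
theorem exists_pick [Finite ι] [Finite M] {F T : Finset ι} {y : ι → M} {v : ℕ → ι}
    {φ : (ι → M) → ℕ → ℝ} {p : ℕ} (hφ : ∀ k ≤ p, DeterminedBy (cube F y) {v k} fun x => φ x k)
    (hT : ¬ Captured F y v φ p T) :
    ∃ w ∈ F, w ∉ T ∧ ∃ b : M, ∀ x ∈ cube F y, x w = b →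
      v (leader (φ x) p) ∈ F → v (leader (φ x) p) ∈ insert w T := by
  simp only [Captured, not_forall] at hT
  obtain ⟨x₁, hx₁, hF₁, hT₁⟩ := hT
  obtain ⟨k₀, hk₀, ⟨hF₀, hT₀⟩, x₀, hx₀, h⟩ := exists_dominant ⟨x₁, hx₁⟩ hφ
    (fun k => v k ∈ F ∧ v k ∉ T) ⟨_, leader_le _ _, hF₁, hT₁⟩
  refine ⟨v k₀, hF₀, hT₀, x₀ (v k₀), fun x hx hxx hF => ?_⟩
  by_contra hn
  rw [Finset.mem_insert, not_or] at hn
  have h1 := h x hx hxx _ (leader_le _ _) ⟨hF, hn.2⟩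
  have h2 := prio_injective _ (le_antisymm h1 (prio_le_prio_leader _ hk₀))
  exact hn.1 (by rw [h2])

/-- A query that is not captured by `s` variables can be captured by fixing one letter, in at least
`s` ways that concern different variables. -/
theorem exists_capturing_letters [Finite ι] [Finite M] {F : Finset ι} {y : ι → M} {v : ℕ → ι}
    {φ : (ι → M) → ℕ → ℝ} {p s : ℕ}
    (hφ : ∀ k ≤ p, DeterminedBy (cube F y) {v k} fun x => φ x k)
    (hs : ∀ T : Finset ι, T.card ≤ s → ¬ Captured F y v φ p T) :
    ∃ T ⊆ F, T.card = s ∧ ∃ b : ι → M, ∀ w ∈ T,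
      Captured (F.erase w) (Function.update y w (b w)) v φ p T := by
  suffices H : ∀ r ≤ s, ∃ T ⊆ F, T.card = r ∧ ∃ b : ι → M, ∀ w ∈ T, ∀ x ∈ cube F y, x w = b w →
      v (leader (φ x) p) ∈ F → v (leader (φ x) p) ∈ T by
    obtain ⟨T, hTF, hTs, b, hb⟩ := H s le_rfl
    refine ⟨T, hTF, hTs, b, fun w hw x hx hv => ?_⟩
    have hxC := cube_subset_cube (F.erase_subset w)
      (update_mem_cube (base_mem_cube F y) (hTF hw) (b w)) hx
    exact hb w hw x hxC (by simpa using hx w (by simp)) (Finset.mem_of_mem_erase hv)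
  intro r
  induction r with
  | zero => exact fun _ => ⟨∅, by simp, rfl, y, by simp⟩
  | succ r ih =>
    intro hr
    obtain ⟨T, hTF, hTr, b, hb⟩ := ih (by omega)
    obtain ⟨w, hwF, hwT, a, ha⟩ := exists_pick hφ (hs T (by omega))
    refine ⟨insert w T, Finset.insert_subset hwF hTF, by rw [Finset.card_insert_of_notMem hwT, hTr],
      Function.update b w a, fun w' hw' x hx hxx hF => ?_⟩
    rcases Finset.mem_insert.1 hw' with rfl | hwT'
    · exact ha x hx (by simpa using hxx) hF
    · rw [Function.update_of_ne (by rintro rfl; exact hwT hwT')] at hxx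
      exact Finset.mem_insert_of_mem (hb w' hwT' x hx hxx hF)

/-- The pigeonhole step: among `u` uncaptured queries, some letter at some free position captures at
least a proportion `s / (|F| * |M|)` of them, and at least one. -/
theorem exists_good_letter [Finite ι] [Fintype M] {Q : Type*} {F : Finset ι} {y : ι → M}
    {v : ℕ → ι} {φ : Q → (ι → M) → ℕ → ℝ} {p : Q → ℕ} {s : ℕ} (hs : 0 < s) (U : Finset Q)
    (hU : U.Nonempty)
    (hφ : ∀ τ ∈ U, ∀ k ≤ p τ, DeterminedBy (cube F y) {v k} fun x => φ τ x k)
    (hcap : ∀ τ ∈ U, ∀ T : Finset ι, T.card ≤ s → ¬ Captured F y v (φ τ) (p τ) T) :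
    ∃ w ∈ F, ∃ b : M, ∃ W ⊆ U, 1 ≤ W.card ∧ U.card * s ≤ W.card * (F.card * Fintype.card M) ∧
      ∀ τ ∈ W, ∃ T : Finset ι, T.card ≤ s ∧
        Captured (F.erase w) (Function.update y w b) v (φ τ) (p τ) T := by
  classical
  have H : ∀ τ : Q, ∃ T : Finset ι, ∃ b : ι → M, τ ∈ U → T ⊆ F ∧ T.card = s ∧ ∀ w ∈ T,
      Captured (F.erase w) (Function.update y w (b w)) v (φ τ) (p τ) T := by
    intro τ
    by_cases hτ : τ ∈ U
    · obtain ⟨T, h1, h2, b, h3⟩ := exists_capturing_letters (hφ τ hτ) (hcap τ hτ)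
      exact ⟨T, b, fun _ => ⟨h1, h2, h3⟩⟩
    · exact ⟨∅, y, fun h => absurd h hτ⟩
  choose T b hTb using H
  let W : ι × M → Finset Q := fun z => U.filter fun τ => z.1 ∈ T τ ∧ b τ z.1 = z.2
  have hcount : ∑ z ∈ F ×ˢ (Finset.univ : Finset M), (W z).card = U.card * s := by
    simp only [W, Finset.card_filter]
    rw [Finset.sum_comm]
    rw [Finset.sum_const_nat (m := s)]
    intro τ hτ
    obtain ⟨hTF, hTs, -⟩ := hTb τ hτ
    rw [Finset.sum_product]
    simp only [← Finset.card_filter]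
    rw [← hTs, Finset.card_eq_sum_ones, ← Finset.sum_subset hTF]
    · refine Finset.sum_congr rfl fun i hi => ?_
      simp [hi, Finset.filter_eq]
    · intro i _ hi
      simp [hi]
  have hpos : 0 < U.card * s := Nat.mul_pos hU.card_pos hs
  have hne : (F ×ˢ (Finset.univ : Finset M)).Nonempty := by
    rw [Finset.nonempty_iff_ne_empty]
    intro h
    rw [h, Finset.sum_empty] at hcount
    omega
  obtain ⟨z, hz, hmax⟩ := Finset.exists_max_image _ (fun z => (W z).card) hne
  have hle : U.card * s ≤ (W z).card * (F.card * Fintype.card M) := by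
    rw [← hcount, mul_comm]
    refine (Finset.sum_le_card_nsmul _ _ _ hmax).trans ?_
    rw [Finset.card_product, Finset.card_univ, smul_eq_mul]
  refine ⟨z.1, (Finset.mem_product.1 hz).1, z.2, W z, Finset.filter_subset _ _, ?_, hle, ?_⟩
  · rcases Nat.eq_zero_or_pos (W z).card with h | h
    · rw [h] at hle; omega
    · exact h
  · intro τ hτ
    obtain ⟨hτU, h1, h2⟩ := Finset.mem_filter.1 hτ
    obtain ⟨-, hs, h3⟩ := hTb τ hτU
    exact ⟨T τ, hs.le, h2 ▸ h3 z.1 h1⟩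

/-- All queries can be captured at once by fixing few letters. Each fixed letter costs `4 * g`, and
`4 * u + g * min (4 * u) A` is a potential of the number `u` of uncaptured queries: as long as
`4 * u ≥ A`, a well-chosen letter captures at least `g` queries, and later on at least one. -/
theorem exists_cube_captured [Finite ι] [Fintype M] [Nonempty M] {Q : Type*} {v : ℕ → ι}
    {φ : Q → (ι → M) → ℕ → ℝ} {p : Q → ℕ} {g A : ℕ} (hg : 0 < g) (Q₀ : Finset Q) (u : ℕ)
    (F : Finset ι) (y : ι → M) (hA : F.card ≤ A)
    (hφ : ∀ τ ∈ Q₀, ∀ k ≤ p τ, DeterminedBy (cube F y) {v k} fun x => φ τ x k)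
    (U : Finset Q) (hU : U ⊆ Q₀) (hUu : U.card ≤ u)
    (hcap : ∀ τ ∈ Q₀, τ ∉ U →
      ∃ T : Finset ι, T.card ≤ 4 * Fintype.card M * g ∧ Captured F y v (φ τ) (p τ) T) :
    ∃ F' ⊆ F, ∃ y' ∈ cube F y,
      4 * g * F.card ≤ 4 * g * F'.card + (4 * U.card + g * min (4 * U.card) A) ∧
      ∀ τ ∈ Q₀, ∃ T : Finset ι, T.card ≤ 4 * Fintype.card M * g ∧
        Captured F' y' v (φ τ) (p τ) T := by
  classical
  induction u generalizing F y U with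
  | zero =>
    obtain rfl : U = ∅ := Finset.card_eq_zero.1 (by omega)
    exact ⟨F, le_rfl, y, base_mem_cube F y, by simp, fun τ hτ => hcap τ hτ (by simp)⟩
  | succ u ih =>
    -- Queries of `U` that happen to be captured already are dropped first.
    set U₁ := U.filter fun τ => ∀ T : Finset ι, T.card ≤ 4 * Fintype.card M * g →
      ¬ Captured F y v (φ τ) (p τ) T with hU₁
    have hU₁U : U₁ ⊆ U := Finset.filter_subset _ _
    have hcard₁ := Finset.card_le_card hU₁U
    have hcap₁ : ∀ τ ∈ Q₀, τ ∉ U₁ → ∃ T : Finset ι, T.card ≤ 4 * Fintype.card M * g ∧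
        Captured F y v (φ τ) (p τ) T := by
      intro τ hτ hτU
      by_cases hτ' : τ ∈ U
      · by_contra hn
        push Not at hn
        exact hτU (Finset.mem_filter.2 ⟨hτ', hn⟩)
      · exact hcap τ hτ hτ'
    rcases U₁.eq_empty_or_nonempty with hne | hne
    · exact ⟨F, le_rfl, y, base_mem_cube F y, by omega,
        fun τ hτ => hcap₁ τ hτ (by simp [hne])⟩
    have hq : 0 < Fintype.card M := Fintype.card_pos
    obtain ⟨w, hw, b, W, hWU, hW1, hWs, hWcap⟩ := exists_good_letter (s := 4 * Fintype.card M * g)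
      (by positivity) U₁ hne (fun τ hτ => hφ τ (hU (hU₁U hτ)))
      (fun τ hτ => (Finset.mem_filter.1 hτ).2)
    have hyw := update_mem_cube (base_mem_cube F y) hw b
    have hsub := cube_subset_cube (F.erase_subset w) hyw
    have hcardW := Finset.card_sdiff_add_card_eq_card hWU
    have hFw := Finset.card_erase_add_one hw
    obtain ⟨F', hF', y', hy', hcost, hall⟩ := ih (F.erase w) (Function.update y w b)
      (by omega) (fun τ hτ k hk => (hφ τ hτ k hk).mono hsub le_rfl) (U₁ \ W)
      (Finset.sdiff_subset.trans (hU₁U.trans hU)) (by omega) (by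
        intro τ hτ hτU
        by_cases hτW : τ ∈ W
        · exact hWcap τ hτW
        · obtain ⟨T, hT, hc⟩ := hcap₁ τ hτ fun h => hτU (Finset.mem_sdiff.2 ⟨h, hτW⟩)
          exact ⟨T, hT, hc.mono (F.erase_subset w) hyw⟩)
    refine ⟨F', hF'.trans (F.erase_subset w), y', hsub hy', ?_, hall⟩
    -- One more fixed letter is paid for by the drop of the potential of the uncaptured queries.
    have hWs' : U₁.card * (4 * g) ≤ W.card * F.card := by
      refine Nat.le_of_mul_le_mul_right ?_ hq
      calc _ = U₁.card * (4 * Fintype.card M * g) := by ring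
        _ ≤ _ := hWs
        _ = _ := by ring
    have hmono : g * min (4 * U₁.card) A ≤ g * min (4 * U.card) A :=
      Nat.mul_le_mul_left _ (by omega)
    rw [← hFw]
    suffices h : 4 * g + (4 * (U₁ \ W).card + g * min (4 * (U₁ \ W).card) A) ≤
        4 * U₁.card + g * min (4 * U₁.card) A by
      rw [mul_add]
      omega
    rcases Nat.lt_or_ge (4 * U₁.card) A with hlt | hge
    · rw [min_eq_left hlt.le, min_eq_left (by omega), ← hcardW]
      nlinarith
    · have hgW : g ≤ W.card := by
        have hF0 : 0 < F.card := by omega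
        refine Nat.le_of_mul_le_mul_right (Nat.le_trans ?_ hWs') hF0
        nlinarith
      have : g * min (4 * (U₁ \ W).card) A ≤ g * A := Nat.mul_le_mul_left _ (min_le_right _ _)
      rw [min_eq_right hge]
      omega

/-! ### Independent variables -/

/-- Among boundedly many sets of bounded size, a positive proportion of the points of `F` can be
chosen such that no set contains two of them. -/
theorem exists_independent {n c t : ℕ} (S : ℕ → Finset ι) (hS : ∀ p < n, (S p).card ≤ c)
    (F : Finset ι) (ht : 2 * (n * c) ≤ t * F.card) :
    ∃ I ⊆ F, F.card ≤ 2 * (1 + t * c) * I.card ∧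
      ∀ p < n, ∀ i ∈ I, ∀ j ∈ I, i ∈ S p → j ∈ S p → i = j := by
  classical
  -- At most half of the points of `F` lie in more than `t` of the sets; the others form `B`.
  let deg : ι → Finset ℕ := fun i => (Finset.range n).filter fun p => i ∈ S p
  let B := F.filter fun i => (deg i).card ≤ t
  have hB : F.card ≤ 2 * B.card := by
    have h1 : (F.filter fun i => ¬ (deg i).card ≤ t).card * (t + 1) ≤ n * c := by
      calc _ = ∑ i ∈ F.filter fun i => ¬ (deg i).card ≤ t, (t + 1) := by
            rw [Finset.sum_const, smul_eq_mul]
        _ ≤ ∑ i ∈ F.filter fun i => ¬ (deg i).card ≤ t, (deg i).card :=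
            Finset.sum_le_sum fun i hi => not_le.1 (Finset.mem_filter.1 hi).2
        _ = ∑ p ∈ Finset.range n,
              ((F.filter fun i => ¬ (deg i).card ≤ t).filter fun i => i ∈ S p).card := by
            simp only [deg, Finset.card_filter (fun p => _ ∈ S p)]
            rw [Finset.sum_comm]
            simp only [Finset.card_filter]
        _ ≤ ∑ p ∈ Finset.range n, c := by
            refine Finset.sum_le_sum fun p hp => le_trans (Finset.card_le_card ?_)
              (hS p (Finset.mem_range.1 hp))
            intro i hi
            exact (Finset.mem_filter.1 hi).2
        _ = n * c := by simp
    have h2 := Finset.card_filter_add_card_filter_not (s := F) fun i => (deg i).card ≤ t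
    change B.card + _ = _ at h2
    by_contra hn
    nlinarith
  let good : Finset ι → Prop := fun I =>
    ∀ p < n, ∀ i ∈ I, ∀ j ∈ I, i ∈ S p → j ∈ S p → i = j
  obtain ⟨I, hI, hmax⟩ := Finset.exists_max_image (B.powerset.filter good) Finset.card
    ⟨∅, by simp [good]⟩
  obtain ⟨hIB, hgood⟩ := Finset.mem_filter.1 hI
  rw [Finset.mem_powerset] at hIB
  refine ⟨I, hIB.trans (Finset.filter_subset _ _), ?_, hgood⟩
  -- By maximality, every point of `B` shares a set with a point of `I`, or lies in `I`.
  have hcover : B ⊆ I ∪ I.biUnion fun i => (deg i).biUnion S := by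
    intro b hb
    by_contra hn
    simp only [Finset.mem_union, Finset.mem_biUnion, not_or, not_exists, not_and] at hn
    obtain ⟨hbI, hn⟩ := hn
    have hfar : ∀ p < n, ∀ i ∈ I, i ∈ S p → b ∉ S p := fun p hp i hi his =>
      hn i hi p (Finset.mem_filter.2 ⟨Finset.mem_range.2 hp, his⟩)
    have := hmax (insert b I) (Finset.mem_filter.2 ⟨Finset.mem_powerset.2
      (Finset.insert_subset hb hIB), by
        intro p hp i hi j hj his hjs
        rcases Finset.mem_insert.1 hi with hi' | hi' <;>
          rcases Finset.mem_insert.1 hj with hj' | hj'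
        · rw [hi', hj']
        · exact absurd (hi' ▸ his) (hfar p hp j hj' hjs)
        · exact absurd (hj' ▸ hjs) (hfar p hp i hi' his)
        · exact hgood p hp i hi' j hj' his hjs⟩)
    rw [Finset.card_insert_of_notMem hbI] at this
    omega
  have h3 : B.card ≤ I.card + I.card * (t * c) := by
    refine (Finset.card_le_card hcover).trans ((Finset.card_union_le _ _).trans ?_)
    refine Nat.add_le_add_left (Finset.card_biUnion_le_card_mul _ _ _ fun i hi => ?_) _
    refine (Finset.card_biUnion_le_card_mul _ _ c fun p hp => ?_).trans
      (Nat.mul_le_mul_right _ (Finset.mem_filter.1 (hIB hi)).2)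
    exact hS p (Finset.mem_range.1 (Finset.mem_filter.1 hp).1)
  nlinarith

end Cube

/-! ### Hard attention layers -/

/-- A hard attention layer on sequences of activations in `V`, reduced to what matters for the
restriction argument: each head compares the current activation with those of the positions to its
left by a score and selects the rightmost maximiser, and the output is a function of the activations
that the heads select. -/
structure HardLayer (V : Type*) where
  heads : ℕ
  score : Fin heads → V → V → ℝ
  out : (Fin heads → V) → V

namespace HardLayer

variable {V : Type*}

/-- The position that head `h` attends to from position `i`. -/
noncomputable def attended (l : HardLayer V) (h : Fin l.heads) (X : ℕ → V) (i : ℕ) : ℕ :=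
  leader (fun k => l.score h (X i) (X k)) i

/-- The output of the layer. -/
noncomputable def eval (l : HardLayer V) (X : ℕ → V) (i : ℕ) : V :=
  l.out fun h => X (l.attended h X i)

theorem attended_le (l : HardLayer V) (h : Fin l.heads) (X : ℕ → V) (i : ℕ) :
    l.attended h X i ≤ i :=
  leader_le _ _

theorem attended_congr (l : HardLayer V) (h : Fin l.heads) {X X' : ℕ → V} {i : ℕ}
    (hX : ∀ k ≤ i, X k = X' k) : l.attended h X i = l.attended h X' i :=
  leader_congr fun k hk => by rw [hX k hk, hX i le_rfl]

theorem eval_congr (l : HardLayer V) {X X' : ℕ → V} {i : ℕ} (hX : ∀ k ≤ i, X k = X' k) :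
    l.eval X i = l.eval X' i := by
  unfold eval
  congr 1
  funext h
  rw [l.attended_congr h hX]
  exact hX _ (l.attended_le h X' i)

/-- The output of a list of layers. -/
noncomputable def evalList (ls : List (HardLayer V)) (X : ℕ → V) : ℕ → V :=
  ls.foldl (fun X l => l.eval X) X

end HardLayer

/-! ### Restricting the input letters -/

section Restriction

variable {ι M V : Type*}

/-- If every activation depends on one letter, then after fixing at most half of the letters, every
output of a hard attention layer depends on a bounded number of letters. -/
theorem HardLayer.exists_cube_eval_determined [DecidableEq ι] [Finite ι] [Fintype M] [Nonempty M]
    (l : HardLayer V) {n H K : ℕ} (hl : l.heads ≤ H) {F : Finset ι} {y : ι → M}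
    (hF : n ≤ K * F.card) {X : (ι → M) → ℕ → V} {v : ℕ → ι}
    (hX : ∀ p < n, DeterminedBy (cube F y) {v p} fun x => X x p) :
    ∃ F' ⊆ F, ∃ y' ∈ cube F y, F.card ≤ 2 * F'.card ∧ ∀ p < n, ∃ S : Finset ι,
      S.card ≤ 1 + H * Fintype.card M *
        (4 * Fintype.card M * (4 * (H * Fintype.card M * K) + 1)) ∧
      DeterminedBy (cube F' y') S fun x => l.eval (X x) p := by
  classical
  set q := Fintype.card M with hq
  set g := 4 * (H * q * K) + 1 with hg
  -- A query consists of a position, a head, and a value of the letter that the activation at this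
  -- position depends on; `Z p a` is the activation at `p` when this letter is `a`.
  let Z : ℕ → M → V := fun p a =>
    if h : ∃ x ∈ cube F y, x (v p) = a then X h.choose p else X y p
  have hZ : ∀ p < n, ∀ x ∈ cube F y, X x p = Z p (x (v p)) := by
    intro p hp x hx
    have h : ∃ x' ∈ cube F y, x' (v p) = x (v p) := ⟨x, hx, rfl⟩
    simp only [Z, dif_pos h]
    exact hX p hp x hx _ h.choose_spec.1 (by simp [h.choose_spec.2])
  let φ : ℕ × Fin l.heads × M → (ι → M) → ℕ → ℝ :=
    fun τ x k => l.score τ.2.1 (Z τ.1 τ.2.2) (X x k)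
  let Q₀ : Finset (ℕ × Fin l.heads × M) := Finset.range n ×ˢ Finset.univ
  have hQ₀ : 4 * Q₀.card ≤ g * F.card := by
    have : Q₀.card = n * (l.heads * q) := by simp [Q₀, hq]
    calc 4 * Q₀.card ≤ 4 * ((K * F.card) * (H * q)) := by rw [this]; gcongr
      _ = (4 * (H * q * K)) * F.card := by ring
      _ ≤ g * F.card := Nat.mul_le_mul_right _ (by omega)
  obtain ⟨F', hF', y', hy', hcost, hcap⟩ := exists_cube_captured (v := v) (φ := φ)
    (p := fun τ => τ.1) (g := g) (A := F.card) (by omega) Q₀ Q₀.card F y le_rfl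
    (by
      rintro ⟨p, h, a⟩ hτ k hk
      have hp : p < n := Finset.mem_range.1 (Finset.mem_product.1 hτ).1
      exact (hX k (hk.trans_lt hp)).comp (l.score h (Z p a))) Q₀ le_rfl le_rfl
    (fun τ h1 h2 => absurd h1 h2)
  have hsub := cube_subset_cube hF' hy'
  refine ⟨F', hF', y', hy', ?_, fun p hp => ?_⟩
  · have h1 : g * min (4 * Q₀.card) F.card ≤ g * F.card :=
      Nat.mul_le_mul_left _ (min_le_right _ _)
    refine Nat.le_of_mul_le_mul_left (?_ : 2 * g * _ ≤ 2 * g * _) (by omega)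
    nlinarith
  · have H' : ∀ z : Fin l.heads × M, ∃ T : Finset ι, T.card ≤ 4 * q * g ∧
        Captured F' y' v (φ (p, z)) p T := fun z => hcap (p, z) (by simp [Q₀, hp])
    choose T hTs hT using H'
    refine ⟨insert (v p) (Finset.univ.biUnion T), ?_, ?_⟩
    · have h1 : (Finset.univ.biUnion T).card ≤ l.heads * q * (4 * q * g) := by
        refine (Finset.card_biUnion_le_card_mul _ _ _ fun z _ => hTs z).trans ?_
        simp [hq]
      have h2 := Finset.card_insert_le (v p) (Finset.univ.biUnion T)
      have h3 : l.heads * q * (4 * q * g) ≤ H * q * (4 * q * g) := by gcongr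
      omega
    · intro x hx x' hx' hxx
      have hvp : x (v p) = x' (v p) := hxx _ (Finset.mem_insert_self _ _)
      have hatt : ∀ h, ∀ x₁ ∈ cube F' y', x₁ (v p) = x (v p) →
          l.attended h (X x₁) p = leader (φ (p, h, x (v p)) x₁) p := by
        intro h x₁ hx₁ hx₁p
        simp only [HardLayer.attended, φ]
        rw [hZ p hp x₁ (hsub hx₁), hx₁p]
      have hread : ∀ h, ∀ x₁ ∈ cube F' y', x₁ (v p) = x (v p) →
          X x (leader (φ (p, h, x (v p)) x₁) p) = X x' (leader (φ (p, h, x (v p)) x₁) p) := by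
        intro h x₁ hx₁ hx₁p
        have hlt := (leader_le (φ (p, h, x (v p)) x₁) p).trans_lt hp
        refine hX _ hlt x (hsub hx) x' (hsub hx') fun i hi => ?_
        rw [Finset.mem_singleton] at hi
        by_cases hiF : i ∈ F'
        · refine hxx i (Finset.mem_insert_of_mem (Finset.mem_biUnion.2
            ⟨(h, x (v p)), Finset.mem_univ _, ?_⟩))
          rw [hi] at hiF ⊢
          exact hT _ x₁ hx₁ hiF
        · exact eq_of_mem_cube hx hx' hiF
      simp only [HardLayer.eval]
      congr 1
      funext h
      rw [hatt h x hx rfl, hatt h x' hx' hvp.symm]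
      have e1 := hread h x hx rfl
      have e2 := hread h x' hx' hvp.symm
      set k := leader (φ (p, h, x (v p)) x) p with hk
      set k' := leader (φ (p, h, x (v p)) x') p with hk'
      -- Each of the two leaders has the same score on both words, so they coincide.
      have hkk : k' = k := by
        refine leader_eq_of_forall_prio_le (leader_le _ _) fun j hj => ?_
        refine (prio_le_prio_leader _ hj).trans ?_
        have h1 : φ (p, h, x (v p)) x' k = φ (p, h, x (v p)) x k := by simp only [φ, e1]
        have h2 : φ (p, h, x (v p)) x k' = φ (p, h, x (v p)) x' k' := by simp only [φ, e2]
        have h3 : prio (φ (p, h, x (v p)) x) k' ≤ prio (φ (p, h, x (v p)) x) k :=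
          prio_le_prio_leader _ (leader_le _ _)
        rw [← hk']
        simpa only [prio, h1, h2] using h3
      rw [hkk, e1]

/-- Every activation at a position `p < n` depends on one letter, for words in `C`. -/
def Single (C : Set (ι → M)) (n : ℕ) (X : (ι → M) → ℕ → V) : Prop :=
  ∃ v : ℕ → ι, ∀ p < n, DeterminedBy C {v p} fun x => X x p

theorem Single.mono {C C' : Set (ι → M)} {n : ℕ} {X : (ι → M) → ℕ → V} (h : Single C n X)
    (hC : C' ⊆ C) : Single C' n X :=
  let ⟨v, hv⟩ := h
  ⟨v, fun p hp => (hv p hp).mono hC le_rfl⟩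

/-- If every activation depends on one letter, then a positive proportion of the letters can be left
free such that every output of a hard attention layer depends on one letter. -/
theorem HardLayer.exists_cube_eval_single (H K q : ℕ) :
    ∃ K' : ℕ, ∀ {ι M V : Type*} [DecidableEq ι] [Finite ι] [Fintype M] [Nonempty M]
      (_ : Fintype.card M = q) (l : HardLayer V) (_ : l.heads ≤ H) (n : ℕ) (F : Finset ι)
      (y : ι → M) (_ : n ≤ K * F.card) (X : (ι → M) → ℕ → V) (_ : Single (cube F y) n X),
      ∃ F' ⊆ F, ∃ y' ∈ cube F y, n ≤ K' * F'.card ∧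
        Single (cube F' y') n fun x => l.eval (X x) := by
  set c := 1 + H * q * (4 * q * (4 * (H * q * K) + 1)) with hc
  refine ⟨4 * K * (1 + 4 * K * c * c), ?_⟩
  intro ι M V _ _ _ _ hq l hl n F y hF X ⟨v, hv⟩
  classical
  obtain ⟨F₁, hF₁, y', hy', hcard, hS⟩ := l.exists_cube_eval_determined hl hF hv
  have H' : ∀ p, ∃ S : Finset ι, p < n → S.card ≤ c ∧
      DeterminedBy (cube F₁ y') S fun x => l.eval (X x) p := by
    intro p
    by_cases hp : p < n
    · obtain ⟨S, h1, h2⟩ := hS p hp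
      rw [hq] at h1
      exact ⟨S, fun _ => ⟨h1, h2⟩⟩
    · exact ⟨∅, fun h => absurd h hp⟩
  choose S hS using H'
  have hn : n ≤ 2 * K * F₁.card := hF.trans (by
    calc K * F.card ≤ K * (2 * F₁.card) := Nat.mul_le_mul_left _ hcard
      _ = _ := by ring)
  obtain ⟨I, hI, hIcard, hind⟩ := exists_independent (t := 4 * K * c) S
    (fun p hp => (hS p hp).1) F₁ (by
      calc 2 * (n * c) ≤ 2 * (2 * K * F₁.card * c) := by gcongr
        _ = _ := by ring)
  refine ⟨I, hI.trans hF₁, y', hy', hn.trans ?_, ?_⟩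
  · calc 2 * K * F₁.card ≤ 2 * K * (2 * (1 + 4 * K * c * c) * I.card) :=
        Nat.mul_le_mul_left _ hIcard
      _ = _ := by ring
  · have hv' : ∀ p, ∃ w : ι, p < n → (S p).filter (· ∈ I) ⊆ {w} := by
      intro p
      by_cases hp : p < n
      · rcases ((S p).filter (· ∈ I)).eq_empty_or_nonempty with h | ⟨w, hw⟩
        · exact ⟨v p, fun _ => by simp [h]⟩
        · refine ⟨w, fun _ i hi => ?_⟩
          rw [Finset.mem_filter] at hi hw
          exact Finset.mem_singleton.2 (hind p hp i hi.2 w hw.2 hi.1 hw.1)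
      · exact ⟨v p, fun h => absurd h hp⟩
    choose w hw using hv'
    refine ⟨w, fun p hp => ?_⟩
    exact ((hS p hp).2.mono (cube_subset_cube hI (base_mem_cube _ _)) le_rfl).of_filter.mono
      le_rfl (hw p hp)

/-- Every activation at a position `p < n`, in each layer, depends on one letter. -/
def AllSingle (C : Set (ι → M)) (n : ℕ) : List (HardLayer V) → ((ι → M) → ℕ → V) → Prop
  | [], X => Single C n X
  | l :: ls, X => Single C n X ∧ AllSingle C n ls fun x => l.eval (X x)

theorem AllSingle.mono {C C' : Set (ι → M)} {n : ℕ} (hC : C' ⊆ C) {ls : List (HardLayer V)}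
    {X : (ι → M) → ℕ → V} (h : AllSingle C n ls X) : AllSingle C' n ls X := by
  induction ls generalizing X with
  | nil => exact Single.mono h hC
  | cons l ls ih => exact ⟨h.1.mono hC, ih h.2⟩

theorem AllSingle.congr {C : Set (ι → M)} {n : ℕ} {ls : List (HardLayer V)}
    {X X' : (ι → M) → ℕ → V} (hX : ∀ x ∈ C, ∀ p < n, X x p = X' x p) (h : AllSingle C n ls X) :
    AllSingle C n ls X' := by
  have hS : Single C n X → Single C n X' := fun ⟨v, hv⟩ =>
    ⟨v, fun p hp => (hv p hp).congr fun x hx => hX x hx p hp⟩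
  induction ls generalizing X X' with
  | nil => exact hS h
  | cons l ls ih =>
    have h' : ∀ x ∈ C, ∀ p < n, l.eval (X x) p = l.eval (X' x) p := fun x hx p hp =>
      l.eval_congr fun k hk => hX x hx k (hk.trans_lt hp)
    exact ⟨hS h.1, ih h' h.2 fun ⟨v, hv⟩ =>
      ⟨v, fun p hp => (hv p hp).congr fun x hx => h' x hx p hp⟩⟩

/-- The restriction lemma for hard attention: for a bounded number of layers and heads, a positive
proportion of the letters can be left free such that every activation depends on one letter. -/
theorem exists_cube_allSingle (H q L : ℕ) :
    ∀ K : ℕ, ∃ K' : ℕ, ∀ {ι M V : Type*} [DecidableEq ι] [Finite ι] [Fintype M] [Nonempty M]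
      (_ : Fintype.card M = q) (ls : List (HardLayer V)) (_ : ls.length ≤ L)
      (_ : ∀ l ∈ ls, l.heads ≤ H) (n : ℕ) (F : Finset ι) (y : ι → M) (_ : n ≤ K * F.card)
      (X : (ι → M) → ℕ → V) (_ : Single (cube F y) n X),
      ∃ F' ⊆ F, ∃ y' ∈ cube F y, n ≤ K' * F'.card ∧ AllSingle (cube F' y') n ls X := by
  induction L with
  | zero =>
    intro K
    refine ⟨K, ?_⟩
    intro ι M V _ _ _ _ _ ls hls _ n F y hF X hX
    obtain rfl : ls = [] := List.eq_nil_of_length_eq_zero (by omega)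
    exact ⟨F, le_rfl, y, base_mem_cube F y, hF, hX⟩
  | succ L ih =>
    intro K
    obtain ⟨K₁, hK₁⟩ := HardLayer.exists_cube_eval_single H K q
    obtain ⟨K₂, hK₂⟩ := ih K₁
    refine ⟨K + K₂, ?_⟩
    intro ι M V _ _ _ _ hq ls hls hH n F y hF X hX
    match ls, hls, hH with
    | [], _, _ =>
      exact ⟨F, le_rfl, y, base_mem_cube F y, hF.trans (Nat.mul_le_mul_right _ (by omega)), hX⟩
    | l :: ls, hls, hH =>
      obtain ⟨F₁, hF₁, y₁, hy₁, hn₁, h₁⟩ := hK₁ hq l (hH l (by simp)) n F y hF X hX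
      obtain ⟨F₂, hF₂, y₂, hy₂, hn₂, h₂⟩ := hK₂ hq ls (by simpa using hls)
        (fun l' hl' => hH l' (by simp [hl'])) n F₁ y₁ hn₁ _ h₁
      have hsub := cube_subset_cube hF₁ hy₁
      exact ⟨F₂, hF₂.trans hF₁, y₂, hsub hy₂, hn₂.trans (Nat.mul_le_mul_right _ (by omega)),
        hX.mono ((cube_subset_cube hF₂ hy₂).trans hsub), h₂⟩

/-! ### Freezing the positions after the input -/

/-- The activations at position `p`, in each layer, are the same for all words in `C`. -/
def Frozen (C : Set (ι → M)) (p : ℕ) : List (HardLayer V) → ((ι → M) → ℕ → V) → Prop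
  | [], X => DeterminedBy C ∅ fun x => X x p
  | l :: ls, X => (DeterminedBy C ∅ fun x => X x p) ∧ Frozen C p ls fun x => l.eval (X x)

theorem Frozen.head {C : Set (ι → M)} {p : ℕ} {ls : List (HardLayer V)}
    {X : (ι → M) → ℕ → V} (h : Frozen C p ls X) : DeterminedBy C ∅ fun x => X x p := by
  cases ls with
  | nil => exact h
  | cons l ls => exact h.1

theorem Frozen.mono {C C' : Set (ι → M)} {p : ℕ} (hC : C' ⊆ C) {ls : List (HardLayer V)}
    {X : (ι → M) → ℕ → V} (h : Frozen C p ls X) : Frozen C' p ls X := by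
  induction ls generalizing X with
  | nil => exact DeterminedBy.mono h hC le_rfl
  | cons l ls ih => exact ⟨h.1.mono hC le_rfl, ih h.2⟩

theorem Frozen.congr {C : Set (ι → M)} {p : ℕ} {ls : List (HardLayer V)}
    {X X' : (ι → M) → ℕ → V} (hX : ∀ x ∈ C, ∀ k ≤ p, X x k = X' x k) (h : Frozen C p ls X) :
    Frozen C p ls X' := by
  induction ls generalizing X X' with
  | nil => exact DeterminedBy.congr h fun x hx => hX x hx p le_rfl
  | cons l ls ih =>
    exact ⟨h.1.congr fun x hx => hX x hx p le_rfl, ih (fun x hx k hk =>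
      l.eval_congr fun j hj => hX x hx j (hj.trans hk)) h.2⟩

theorem Frozen.evalList {C : Set (ι → M)} {p : ℕ} {ls : List (HardLayer V)}
    {X : (ι → M) → ℕ → V} (h : Frozen C p ls X) :
    DeterminedBy C ∅ fun x => HardLayer.evalList ls (X x) p := by
  induction ls generalizing X with
  | nil => exact h
  | cons l ls ih => exact ih h.2

/-- At a position after the input, one fixed letter per head makes the output of a layer
constant. -/
theorem HardLayer.exists_cube_eval_const [DecidableEq ι] [Finite ι] [Finite M]
    (l : HardLayer V) {n p : ℕ} {F : Finset ι} {y : ι → M}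
    {X : (ι → M) → ℕ → V} (hX : Single (cube F y) n X)
    (hc : ∀ k, n ≤ k → k ≤ p → DeterminedBy (cube F y) ∅ fun x => X x k) (hp : n ≤ p) :
    ∃ F' ⊆ F, ∃ y' ∈ cube F y, F.card ≤ F'.card + l.heads ∧
      DeterminedBy (cube F' y') ∅ fun x => l.eval (X x) p := by
  obtain ⟨v, hv⟩ := hX
  have hvk : ∀ k ≤ p, DeterminedBy (cube F y) {v k} fun x => X x k := by
    intro k hk
    rcases Nat.lt_or_ge k n with h | h
    · exact hv k h
    · exact (hc k h hk).mono le_rfl (Finset.empty_subset _)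
  suffices H : ∀ B : Finset (Fin l.heads), ∃ F' ⊆ F, ∃ y' ∈ cube F y, F.card ≤ F'.card + B.card ∧
      ∀ h ∈ B, DeterminedBy (cube F' y') ∅ fun x => X x (l.attended h (X x) p) by
    obtain ⟨F', hF', y', hy', hcard, hB⟩ := H Finset.univ
    refine ⟨F', hF', y', hy', by simpa using hcard, fun x hx x' hx' hxx => ?_⟩
    simp only [HardLayer.eval]
    congr 1
    funext h
    exact hB h (Finset.mem_univ h) x hx x' hx' hxx
  intro B
  induction B using Finset.induction_on with
  | empty => exact ⟨F, le_rfl, y, base_mem_cube F y, by simp, by simp⟩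
  | insert h B hh ih =>
    obtain ⟨F₁, hF₁, y₁, hy₁, hcard, hB⟩ := ih
    have hsub := cube_subset_cube hF₁ hy₁
    have hφ : ∀ k ≤ p, DeterminedBy (cube F₁ y₁) {v k} fun x => l.score h (X x p) (X x k) := by
      intro k hk x hx x' hx' hxx
      have e1 : X x p = X x' p := hc p hp le_rfl x (hsub hx) x' (hsub hx') (by simp)
      have e2 : X x k = X x' k := hvk k hk x (hsub hx) x' (hsub hx') hxx
      simp only [e1, e2]
    obtain ⟨k₀, hk₀, -, x₀, hx₀, hdom⟩ := exists_dominant ⟨y₁, base_mem_cube F₁ y₁⟩ hφ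
      (fun _ => True) ⟨p, le_rfl, trivial⟩
    have hsub₀ := cube_subset_cube (F₁.erase_subset (v k₀)) hx₀
    refine ⟨F₁.erase (v k₀), (F₁.erase_subset _).trans hF₁, x₀, hsub hx₀, ?_, ?_⟩
    · have := Finset.pred_card_le_card_erase (s := F₁) (a := v k₀)
      rw [Finset.card_insert_of_notMem hh]
      omega
    · intro h' hh'
      rcases Finset.mem_insert.1 hh' with rfl | hh'
      · have hatt : ∀ x ∈ cube (F₁.erase (v k₀)) x₀, l.attended h' (X x) p = k₀ ∧
            x (v k₀) = x₀ (v k₀) := by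
          intro x hx
          have hxv : x (v k₀) = x₀ (v k₀) := hx _ (by simp)
          exact ⟨leader_eq_of_forall_prio_le hk₀ fun j hj =>
            hdom x (hsub₀ hx) hxv j hj trivial, hxv⟩
        intro x hx x' hx' _
        obtain ⟨e1, e2⟩ := hatt x hx
        obtain ⟨e1', e2'⟩ := hatt x' hx'
        simp only [e1, e1']
        exact hvk k₀ hk₀ x (hsub (hsub₀ hx)) x' (hsub (hsub₀ hx')) (by simp [e2, e2'])
      · exact (hB h' hh').mono hsub₀ le_rfl

/-- A new position after the input is frozen by fixing one letter per layer and head. -/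
theorem exists_cube_frozen [DecidableEq ι] [Finite ι] [Finite M] {H n p : ℕ} (hp : n ≤ p)
    (ls : List (HardLayer V)) (hH : ∀ l ∈ ls, l.heads ≤ H) {F : Finset ι} {y : ι → M}
    {X : (ι → M) → ℕ → V} (hS : AllSingle (cube F y) n ls X)
    (hfr : ∀ k, n ≤ k → k < p → Frozen (cube F y) k ls X)
    (hpX : DeterminedBy (cube F y) ∅ fun x => X x p) :
    ∃ F' ⊆ F, ∃ y' ∈ cube F y, F.card ≤ F'.card + ls.length * H ∧ Frozen (cube F' y') p ls X := by
  induction ls generalizing F y X with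
  | nil => exact ⟨F, le_rfl, y, base_mem_cube F y, by simp, hpX⟩
  | cons l ls ih =>
    obtain ⟨F₁, hF₁, y₁, hy₁, hcard₁, h₁⟩ := l.exists_cube_eval_const hS.1 (p := p) (by
      intro k hk hkp
      rcases hkp.lt_or_eq with h | rfl
      · exact (hfr k hk h).head
      · exact hpX) hp
    have hsub := cube_subset_cube hF₁ hy₁
    obtain ⟨F₂, hF₂, y₂, hy₂, hcard₂, h₂⟩ := ih (fun l' hl' => hH l' (by simp [hl']))
      (hS.2.mono hsub) (fun k hk hkp => (hfr k hk hkp).2.mono hsub) h₁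
    refine ⟨F₂, hF₂.trans hF₁, y₂, hsub hy₂, ?_,
      hpX.mono ((cube_subset_cube hF₂ hy₂).trans hsub) le_rfl, h₂⟩
    have := hH l (by simp)
    rw [List.length_cons, add_mul]
    omega

end Restriction

/-! ### Transformers as lists of hard attention layers -/

/-- The hard attention layer that a transformer layer performs on the rows of its input. -/
noncomputable def UHATLayer.toHard {d m : ℕ} (l : UHATLayer d m) : HardLayer (Fin d → ℝ) where
  heads := l.heads
  score h u v := dotProduct (Matrix.vecMul u (l.WQ h)) (Matrix.vecMul v (l.WK h))
  out Y := l.mlp (Matrix.vecMul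
    (fun p : Fin l.heads × Fin m => Matrix.vecMul (Y p.1) (l.WV p.1) p.2) l.WO)

/-- A row of the attention matrix is the indicator of the leading position. -/
theorem hardAttention_apply {n : ℕ} (S : Matrix (Fin n) (Fin n) ℝ) {φ : ℕ → ℝ} {i : Fin n}
    (hφ : ∀ k : Fin n, S i k = φ k) (j : Fin n) :
    hardAttention S i j = if (j : ℕ) = leader φ i then 1 else 0 := by
  have hlt : leader φ i < n := (leader_le φ i).trans_lt i.2
  simp only [hardAttention, Matrix.of_apply, hφ]
  congr 1
  apply propext
  constructor
  · rintro ⟨h1, h2, h3⟩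
    refine (leader_eq_of_forall_prio_le h1 fun k hk => ?_).symm
    have h2' := h2 ⟨k, hk.trans_lt i.2⟩ hk
    have h3' := h3 ⟨k, hk.trans_lt i.2⟩ hk
    rw [prio, prio, Prod.Lex.toLex_le_toLex]
    rcases Nat.lt_or_ge j k with h | h
    · exact Or.inl (h3' h)
    · rcases h2'.lt_or_eq with h' | h'
      · exact Or.inl h'
      · exact Or.inr ⟨h', h⟩
  · intro hj
    have hmax : ∀ k : Fin n, k ≤ i → φ k < φ j ∨ φ k = φ j ∧ (k : ℕ) ≤ j := by
      intro k hk
      have := prio_le_prio_leader φ (i := i) (k := k) hk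
      rwa [← hj, prio, prio, Prod.Lex.toLex_le_toLex] at this
    refine ⟨?_, fun k hk => ?_, fun k hk hjk => ?_⟩
    · rw [Fin.le_def, hj]
      exact leader_le φ i
    · rcases hmax k hk with h | h
      · exact h.le
      · exact h.1.le
    · rcases hmax k hk with h | h
      · exact h
      · exact absurd h.2 (not_le.2 hjk)

theorem UHATLayer.apply_eq_eval {d m n : ℕ} (l : UHATLayer d m) (X : Matrix (Fin n) (Fin d) ℝ)
    (X' : ℕ → Fin d → ℝ) (hX : ∀ i : Fin n, X i = X' i) (i : Fin n) :
    l.apply X i = l.toHard.eval X' i := by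
  have hhead : ∀ h c, l.head X h i c =
      Matrix.vecMul (X' (l.toHard.attended h X' i)) (l.WV h) c := by
    intro h c
    have hS : ∀ k : Fin n, (X * l.WQ h * (l.WK h).transpose * X.transpose) i k =
        l.toHard.score h (X' i) (X' k) := by
      intro k
      rw [Matrix.mul_assoc, ← Matrix.transpose_mul, Matrix.mul_apply', ← hX, ← hX]
      rfl
    have hlt : l.toHard.attended h X' i < n := (l.toHard.attended_le h X' i).trans_lt i.2
    rw [UHATLayer.head, Matrix.mul_apply, Finset.sum_eq_single ⟨_, hlt⟩]
    · have h1 := (hardAttention_apply _ (φ := fun k => l.toHard.score h (X' i) (X' k)) hS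
        ⟨_, hlt⟩).trans (if_pos rfl)
      rw [h1, one_mul, Matrix.mul_apply_eq_vecMul, hX]
    · intro j _ hj
      rw [hardAttention_apply _ (φ := fun k => l.toHard.score h (X' i) (X' k)) hS, if_neg, zero_mul]
      exact fun h' => hj (Fin.ext h')
    · simp
  change l.mlp (l.multiHead X i) = _
  rw [UHATLayer.multiHead, Matrix.mul_apply_eq_vecMul]
  change l.mlp (Matrix.vecMul (fun p : Fin l.heads × Fin m => l.head X p.1 i p.2) l.WO) = _
  simp only [hhead]
  rfl

namespace UHAT

variable {α : Type*}

/-- The layers of the transformer, as hard attention layers. -/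
noncomputable def hardLayers (T : UHAT α) : List (HardLayer (Fin T.d → ℝ)) :=
  T.layers.map UHATLayer.toHard

/-- The embedded token string, continued by zeros. -/
noncomputable def input (T : UHAT α) (s : List α) (p : ℕ) : Fin T.d → ℝ :=
  if h : p < s.length then T.embed s[p] + T.pos p else 0

theorem run_eq_evalList (T : UHAT α) (s : List α) (i : Fin s.length) :
    T.run s i = HardLayer.evalList T.hardLayers (T.input s) i := by
  suffices H : ∀ (ls : List (UHATLayer T.d T.m)) (X : Matrix (Fin s.length) (Fin T.d) ℝ)
      (X' : ℕ → Fin T.d → ℝ) (_ : ∀ i : Fin s.length, X i = X' i) (i : Fin s.length),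
      ls.foldl (fun X l => l.apply X) X i =
        HardLayer.evalList (ls.map UHATLayer.toHard) X' i by
    refine H T.layers _ _ (fun i => ?_) i
    simp only [input, dif_pos i.2]
    rfl
  intro ls
  induction ls with
  | nil => exact fun X X' hX i => hX i
  | cons l ls ih => exact fun X X' hX i => ih _ _ (fun i => l.apply_eq_eval X X' hX i) i

theorem Predicts.iff_decode_evalList {T : UHAT α} {s : List α} (hs : s ≠ []) {a : α} :
    T.Predicts s a ↔
      T.decode (HardLayer.evalList T.hardLayers (T.input s) (s.length - 1)) = a := by
  have hpos : 0 < s.length := List.length_pos_of_ne_nil hs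
  constructor
  · rintro ⟨i, hi, rfl⟩
    rw [run_eq_evalList, show s.length - 1 = (i : ℕ) by omega]
  · intro h
    exact ⟨⟨s.length - 1, by omega⟩, by simp; omega, by rw [run_eq_evalList]; exact h⟩

theorem Predicts.unique {T : UHAT α} {s : List α} {a b : α} (ha : T.Predicts s a)
    (hb : T.Predicts s b) : a = b := by
  obtain ⟨i, hi, rfl⟩ := ha
  obtain ⟨j, hj, rfl⟩ := hb
  obtain rfl : i = j := Fin.ext (by omega)
  rfl

theorem input_append_of_lt (T : UHAT α) {s u : List α} {p : ℕ} (hp : p < s.length) :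
    T.input (s ++ u) p = T.input s p := by
  have : p < (s ++ u).length := by rw [List.length_append]; omega
  simp only [input, dif_pos hp, dif_pos this, List.getElem_append_left hp]

end UHAT

/-! ### Paths and messages in communication graphs -/

/-- The token by which an agent emits the outgoing edges of a node. -/
def AgentAction.token {Ξ : Type*} {w : ℕ} : AgentAction Ξ w → Option (Token Ξ)
  | .none => Option.none
  | .cot σ => some (Token.sym σ)
  | .send σ j => some (Token.send σ j)
  | .bcast σ => some (Token.bcast σ)

theorem AgentAction.token_injective {Ξ : Type*} {w : ℕ} :
    Function.Injective (AgentAction.token : AgentAction Ξ w → Option (Token Ξ)) := by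
  intro A B h
  cases A <;> cases B <;> simp_all [AgentAction.token, Fin.ext_iff]

theorem AgentAction.token_ne_eos {Ξ : Type*} {w : ℕ} (A : AgentAction Ξ w) :
    A.token ≠ some Token.eos := by
  cases A <;> simp [AgentAction.token]

namespace CommGraph

variable {Ξ : Type*} {w : ℕ} {G G' : CommGraph Ξ w} {Λ Λ' : Finset Ξ}

theorem outTokens_eq_toList (G : CommGraph Ξ w) (i : Fin w) (t : ℕ) :
    G.outTokens i t = (G.act i t).token.toList := by
  unfold outTokens
  cases G.act i t <;> rfl

theorem msg_self (G : CommGraph Ξ w) (i : Fin w) (t : ℕ) : G.msg i t i = none := by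
  simp [msg]

theorem msg_congr {i : Fin w} {t : ℕ} (h : G.act i t = G'.act i t) (j : Fin w) :
    G.msg i t j = G'.msg i t j := by
  simp only [msg, h]

theorem exists_token_isMessage_of_msg {i j : Fin w} {t : ℕ} {σ : Ξ} (h : G.msg i t j = some σ) :
    ∃ a, (G.act i t).token = some a ∧ a.IsMessage := by
  unfold msg at h
  cases hA : G.act i t <;> simp [hA] at h <;> simp [AgentAction.token, Token.IsMessage]

theorem HasCot.token {i : Fin w} {t : ℕ} (h : G.HasCot i t) : (G.act i t).token ≠ none := by
  obtain ⟨σ, h⟩ := h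
  simp [h, AgentAction.token]

theorem WellFormed.lt_len_of_token (hG : G.WellFormed Λ) {i : Fin w} {t : ℕ} {a : Token Ξ}
    (h : (G.act i t).token = some a) : t < G.len i := by
  by_contra hn
  rw [hG.act_eq_none i t (not_lt.1 hn)] at h
  simp [AgentAction.token] at h

theorem WellFormed.lt_len_of_edge (hG : G.WellFormed Λ) {u v : Fin w × ℕ} (h : G.Edge u v) :
    v.2 < G.len v.1 := by
  obtain ⟨i, t⟩ := u
  obtain ⟨j, s⟩ := v
  obtain rfl : s = t + 1 := h.1
  exact hG.edge_node i t j h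

theorem WellFormed.exists_relSeries (hG : G.WellFormed Λ) (t : ℕ) (j : Fin w) (h : t < G.len j) :
    ∃ p : RelSeries {e : (Fin w × ℕ) × (Fin w × ℕ) | G.Edge e.1 e.2},
      p.length = t ∧ p.last = (j, t) := by
  induction t generalizing j with
  | zero => exact ⟨RelSeries.singleton _ (j, 0), rfl, rfl⟩
  | succ t ih =>
    obtain ⟨i, hi, -⟩ := hG.unique_incoming j t h
    have hit : t < G.len i := by
      rcases hi.2 with ⟨-, hc⟩ | ⟨σ, hm⟩
      · obtain ⟨a, ha⟩ := Option.ne_none_iff_exists'.1 hc.token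
        exact hG.lt_len_of_token ha
      · obtain ⟨a, ha, -⟩ := exists_token_isMessage_of_msg hm
        exact hG.lt_len_of_token ha
    obtain ⟨p, hp, hpl⟩ := ih i hit
    exact ⟨p.snoc (j, t + 1) (by rw [hpl]; exact hi), by simp [hp], by simp⟩

theorem WellFormed.bddAbove_length (hG : G.WellFormed Λ) :
    BddAbove {k | ∃ p : RelSeries {e : (Fin w × ℕ) × (Fin w × ℕ) | G.Edge e.1 e.2},
      p.length = k} := by
  refine ⟨∑ j, G.len j, ?_⟩
  rintro k ⟨p, rfl⟩
  have htime : ∀ (i : ℕ) (hi : i < p.length + 1), i ≤ (p ⟨i, hi⟩).2 := by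
    intro i
    induction i with
    | zero => exact fun _ => Nat.zero_le _
    | succ i ih =>
      intro hi
      have h1 : G.Edge (p ⟨i, by omega⟩) (p ⟨i + 1, hi⟩) := p.step ⟨i, by omega⟩
      have h2 := ih (by omega)
      have h3 := h1.1
      omega
  rcases Nat.eq_zero_or_pos p.length with h0 | h0
  · omega
  · have h1 : G.Edge (p ⟨p.length - 1, by omega⟩) (p ⟨p.length - 1 + 1, by omega⟩) :=
      p.step ⟨p.length - 1, by omega⟩
    have h2 := hG.lt_len_of_edge h1
    have h3 := htime (p.length - 1 + 1) (by omega)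
    have h4 := Finset.single_le_sum (f := G.len) (fun _ _ => Nat.zero_le _)
      (Finset.mem_univ (p ⟨p.length - 1 + 1, by omega⟩).1)
    omega

/-- Every node has an incoming edge from the previous time, so each agent traces back a path. -/
theorem WellFormed.len_le_depth_add_one (hG : G.WellFormed Λ) (j : Fin w) :
    G.len j ≤ G.depth + 1 := by
  rcases Nat.eq_zero_or_pos (G.len j) with h | h
  · omega
  · obtain ⟨p, hp, -⟩ := hG.exists_relSeries (G.len j - 1) j (by omega)
    have : G.len j - 1 ≤ G.depth := le_csSup hG.bddAbove_length ⟨p, hp⟩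
    omega

theorem WellFormed.one_le_depth (hG : G.WellFormed Λ) {i : Fin w} {σ : Ξ} (h : G.LastCot i σ) :
    1 ≤ G.depth := by
  obtain ⟨t, ht, -⟩ := h
  have h1 := hG.edge_node i t i ⟨rfl, Or.inl ⟨rfl, σ, ht⟩⟩
  have h2 := hG.len_le_depth_add_one i
  omega

/-- A node of positive time receives at most one message. -/
theorem WellFormed.length_recvTokens_le (hG : G.WellFormed Λ) (j : Fin w) (t : ℕ) :
    (G.recvTokens j t).length ≤ 1 := by
  cases t with
  | zero => simp [recvTokens]
  | succ t =>
    rw [recvTokens, List.length_map]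
    by_contra hn
    have hnd : (List.finRange w).Nodup := List.nodup_finRange w
    have huniq : ∀ i i', (G.msg i t j).isSome → (G.msg i' t j).isSome → i = i' := by
      intro i i' hi hi'
      obtain ⟨σ, hσ⟩ := Option.isSome_iff_exists.1 hi
      obtain ⟨σ', hσ'⟩ := Option.isSome_iff_exists.1 hi'
      have e : G.Edge (i, t) (j, t + 1) := ⟨rfl, Or.inr ⟨σ, hσ⟩⟩
      exact (hG.unique_incoming j t (hG.edge_node i t j e)).unique e ⟨rfl, Or.inr ⟨σ', hσ'⟩⟩
    have hlen : ((List.finRange w).filterMap fun i => G.msg i t j).length =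
        ((List.finRange w).filter fun i => (G.msg i t j).isSome).length := by
      rw [← List.countP_eq_length_filter, List.length_filterMap_eq_countP]
    rw [hlen, ← List.toFinset_card_of_nodup (hnd.filter _)] at hn
    refine hn (Finset.card_le_one.2 fun a ha b hb => huniq a b ?_ ?_)
    · simpa using ha
    · simpa using hb

theorem length_outTokens_le (G : CommGraph Ξ w) (i : Fin w) (t : ℕ) :
    (G.outTokens i t).length ≤ 1 := by
  rw [outTokens_eq_toList]
  cases (G.act i t).token <;> simp

theorem WellFormed.finite_senders (hG : G.WellFormed Λ) :
    {v : Fin w × ℕ | ∃ j σ, G.msg v.1 v.2 j = some σ}.Finite := by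
  refine ((Set.finite_univ (α := Fin w)).prod (Set.finite_Iio (∑ j, G.len j))).subset ?_
  rintro ⟨i, t⟩ ⟨j, σ, h⟩
  obtain ⟨a, ha, -⟩ := exists_token_isMessage_of_msg h
  have h1 := hG.lt_len_of_token ha
  have h2 := Finset.single_le_sum (f := G.len) (fun _ _ => Nat.zero_le _) (Finset.mem_univ i)
  exact ⟨trivial, h1.trans_le h2⟩

/-- Agent `i` sends or broadcasts some message. -/
def Sends (G : CommGraph Ξ w) (i : Fin w) : Prop := ∃ t j σ, G.msg i t j = some σ

theorem WellFormed.ncard_sends_le (hG : G.WellFormed Λ) :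
    {i | G.Sends i}.ncard ≤ G.commBudget := by
  refine le_trans (Set.ncard_le_ncard ?_ (hG.finite_senders.image Prod.fst))
    (Set.ncard_image_le hG.finite_senders)
  rintro i ⟨t, j, σ, h⟩
  exact ⟨(i, t), ⟨j, σ, h⟩, rfl⟩

/-! ### Agents are deterministic -/

/-- The tokens of agent `i` after its input chunk, up to and including the nodes of times
`0, …, t - 1`. -/
def trace (G : CommGraph Ξ w) (i : Fin w) (t : ℕ) : List (Token Ξ) :=
  [Token.ident i] ++ (List.range t).flatMap fun s => G.recvTokens i s ++ G.outTokens i s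

theorem history_eq_append_trace (G : CommGraph Ξ w) (c : List Ξ) (i : Fin w) (t : ℕ) :
    G.history c i t = c.map Token.sym ++ G.trace i t := by
  simp [history, trace]

theorem trace_succ (G : CommGraph Ξ w) (i : Fin w) (t : ℕ) :
    G.trace i (t + 1) = G.trace i t ++ G.recvTokens i t ++ G.outTokens i t := by
  simp [trace, List.range_succ]

theorem history_succ (G : CommGraph Ξ w) (c : List Ξ) (i : Fin w) (t : ℕ) :
    G.history c i (t + 1) = G.contextAt c i t ++ G.outTokens i t := by
  simp [contextAt, history_eq_append_trace, trace_succ]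

/-- The node `(j, t)` has an incoming edge. -/
def HasIncoming (G : CommGraph Ξ w) (j : Fin w) : ℕ → Prop
  | 0 => False
  | t + 1 => ∃ i, G.Edge (i, t) (j, t + 1)

variable {c c' : Fin w → List Ξ} {T : UHAT (Token Ξ)}

theorem ImplementedBy.predicts_token (hT : G.ImplementedBy c T) (hG : G.WellFormed Λ) {j : Fin w}
    {t : ℕ} {a : Token Ξ} (h : (G.act j t).token = some a) :
    T.Predicts (G.contextAt (c j) j t) a :=
  hT.predicts_out j t (hG.lt_len_of_token h) a (by simp [outTokens_eq_toList, h])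

/-- A node at which a token other than `eos` is emitted exists in each graph in which the same token
is predicted and the incoming edges agree: if it did not, the prediction at this node would be
`eos`. -/
theorem lt_len_transfer (hG : G.WellFormed Λ) (hG' : G'.WellFormed Λ')
    (hT' : G'.ImplementedBy c' T) {j : Fin w} {t : ℕ} {a : Token Ξ}
    (ha : (G.act j t).token = some a) (hpred : T.Predicts (G'.contextAt (c' j) j t) a)
    (hnode : G.HasIncoming j t → G'.HasIncoming j t) : t < G'.len j := by
  cases t with
  | zero =>
    by_contra hn
    have h1 := hT'.predicts_eos j
    rw [show G'.len j = 0 by omega] at h1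
    rw [contextAt, recvTokens, List.append_nil] at hpred
    exact AgentAction.token_ne_eos _ (by rw [ha, hpred.unique h1])
  | succ t =>
    obtain ⟨i, hi, -⟩ := hG.unique_incoming j t (hG.lt_len_of_token ha)
    obtain ⟨i', hi'⟩ := hnode ⟨i, hi⟩
    exact hG'.edge_node i' t j hi'

/-- Messages are determined by the predictions, since a predicted message is always sent. -/
theorem token_transfer_of_isMessage (hG : G.WellFormed Λ) (hG' : G'.WellFormed Λ')
    (hT : G.ImplementedBy c T) (hT' : G'.ImplementedBy c' T) {j : Fin w} {t : ℕ}
    (hpred : ∀ a, T.Predicts (G.contextAt (c j) j t) a → T.Predicts (G'.contextAt (c' j) j t) a)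
    (hnode : G.HasIncoming j t → G'.HasIncoming j t) {a : Token Ξ}
    (ha : (G.act j t).token = some a) (hm : a.IsMessage) : (G'.act j t).token = some a := by
  have hp := hpred a (hT.predicts_token hG ha)
  have hlt := lt_len_transfer hG hG' hT' ha hp hnode
  rcases hb : (G'.act j t).token with _ | b
  · exact absurd hm (hT'.sends_messages j t hlt (AgentAction.token_injective hb) a hp)
  · rw [hp.unique (hT'.predicts_token hG' hb)]

/-- A predicted chain-of-thought token is emitted unless an incoming message overrides it. -/
theorem token_transfer (hG : G.WellFormed Λ) (hG' : G'.WellFormed Λ')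
    (hT : G.ImplementedBy c T) (hT' : G'.ImplementedBy c' T) {j : Fin w} {t : ℕ}
    (hpred : ∀ a, T.Predicts (G.contextAt (c j) j t) a → T.Predicts (G'.contextAt (c' j) j t) a)
    (hnode : G.HasIncoming j t → G'.HasIncoming j t)
    (hmsg : ∀ u σ, G'.msg u t j = some σ → G.msg u t j = some σ) {a : Token Ξ}
    (ha : (G.act j t).token = some a) : (G'.act j t).token = some a := by
  by_cases hm : a.IsMessage
  · exact token_transfer_of_isMessage hG hG' hT hT' hpred hnode ha hm
  have hp := hpred a (hT.predicts_token hG ha)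
  have hlt := lt_len_transfer hG hG' hT' ha hp hnode
  rcases hb : (G'.act j t).token with _ | b
  · exfalso
    rcases Nat.lt_or_ge (t + 1) (G'.len j) with h | h
    · obtain ⟨u, hu, -⟩ := hG'.unique_incoming j t h
      rcases hu.2 with ⟨huj, hc⟩ | ⟨σ, hσ⟩
      · obtain rfl : u = j := huj
        exact hc.token hb
      · -- The message would meet the chain-of-thought edge of the other graph in one node.
        have hσ' := hmsg u σ hσ
        have hcot : G.HasCot j t := by
          cases hA : G.act j t with
          | cot τ => exact ⟨τ, hA⟩
          | none => simp [hA, AgentAction.token] at ha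
          | send τ k =>
            rw [hA] at ha
            exact absurd (by rw [← Option.some.inj ha]; trivial) hm
          | bcast τ =>
            rw [hA] at ha
            exact absurd (by rw [← Option.some.inj ha]; trivial) hm
        have e : G.Edge (u, t) (j, t + 1) := ⟨rfl, Or.inr ⟨σ, hσ'⟩⟩
        have huj : u = j := (hG.unique_incoming j t (hG.edge_node u t j e)).unique e
          ⟨rfl, Or.inl ⟨rfl, hcot⟩⟩
        rw [huj, msg_self] at hσ'
        cases hσ'
    · have h1 := hT'.predicts_eos j
      rw [show G'.len j = t + 1 by omega, history_succ, outTokens_eq_toList, hb,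
        Option.toList_none, List.append_nil] at h1
      exact AgentAction.token_ne_eos _ (by rw [ha, hp.unique h1])
  · rw [hp.unique (hT'.predicts_token hG' hb)]

/-- Up to (excluding) time `t`, the agents in `P` act in the same way in both graphs, and the other
agents send no messages. -/
def AgreeBefore (G G' : CommGraph Ξ w) (P : Set (Fin w)) (t : ℕ) : Prop :=
  ∀ s < t, (∀ k ∈ P, G.act k s = G'.act k s) ∧
    ∀ k, k ∉ P → ∀ j, G.msg k s j = none ∧ G'.msg k s j = none

variable {P : Set (Fin w)} {t : ℕ}

theorem AgreeBefore.msg_eq (h : AgreeBefore G G' P t) {s : ℕ} (hs : s < t) (k j : Fin w) :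
    G.msg k s j = G'.msg k s j := by
  by_cases hk : k ∈ P
  · exact msg_congr ((h s hs).1 k hk) j
  · obtain ⟨h1, h2⟩ := (h s hs).2 k hk j
    rw [h1, h2]

theorem AgreeBefore.recvTokens_eq (h : AgreeBefore G G' P t) {s : ℕ} (hs : s ≤ t) (j : Fin w) :
    G.recvTokens j s = G'.recvTokens j s := by
  cases s with
  | zero => rfl
  | succ s => simp only [recvTokens, h.msg_eq hs]

theorem AgreeBefore.trace_eq (h : AgreeBefore G G' P t) {j : Fin w} (hj : j ∈ P) {s : ℕ}
    (hs : s ≤ t) : G.trace j s = G'.trace j s := by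
  induction s with
  | zero => simp [trace]
  | succ s ih =>
    rw [trace_succ, trace_succ, ih (by omega), h.recvTokens_eq (by omega), outTokens_eq_toList,
      outTokens_eq_toList, (h s hs).1 j hj]

theorem AgreeBefore.contextAt_eq (h : AgreeBefore G G' P t) {j : Fin w} (hj : j ∈ P)
    (l : List Ξ) : G.contextAt l j t = G'.contextAt l j t := by
  rw [contextAt, contextAt, history_eq_append_trace, history_eq_append_trace,
    h.trace_eq hj le_rfl, h.recvTokens_eq le_rfl]

theorem AgreeBefore.hasIncoming_iff (h : AgreeBefore G G' P t) {j : Fin w} (hj : j ∈ P) :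
    G.HasIncoming j t ↔ G'.HasIncoming j t := by
  cases t with
  | zero => rfl
  | succ t =>
    refine exists_congr fun i => ?_
    have hc : (i = j ∧ G.HasCot i t) ↔ (i = j ∧ G'.HasCot i t) := by
      refine and_congr_right ?_
      rintro rfl
      rw [HasCot, HasCot, (h t (by omega)).1 i hj]
    simp only [Edge, true_and, h.msg_eq (Nat.lt_succ_self t), hc]

/-- If the transformer predicts the same tokens at time `t`, and the past is the same, then the
agents act in the same way at time `t`. -/
theorem AgreeBefore.succ (h : AgreeBefore G G' P t) (hG : G.WellFormed Λ) (hG' : G'.WellFormed Λ')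
    (hT : G.ImplementedBy c T) (hT' : G'.ImplementedBy c' T)
    (hsil : ∀ k, k ∉ P → ∀ j, G.msg k t j = none ∧ G'.msg k t j = none)
    (hpred : ∀ j ∈ P, ∀ a,
      T.Predicts (G.contextAt (c j) j t) a ↔ T.Predicts (G'.contextAt (c' j) j t) a) :
    AgreeBefore G G' P (t + 1) := by
  have hmsg : ∀ k j σ, G.msg k t j = some σ ↔ G'.msg k t j = some σ := by
    intro k j σ
    by_cases hk : k ∈ P
    · constructor
      · intro hm
        obtain ⟨a, ha, ham⟩ := exists_token_isMessage_of_msg hm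
        have := token_transfer_of_isMessage hG hG' hT hT' (fun a => (hpred k hk a).1)
          (h.hasIncoming_iff hk).1 ha ham
        rwa [← msg_congr (AgentAction.token_injective (ha.trans this.symm))]
      · intro hm
        obtain ⟨a, ha, ham⟩ := exists_token_isMessage_of_msg hm
        have := token_transfer_of_isMessage hG' hG hT' hT (fun a => (hpred k hk a).2)
          (h.hasIncoming_iff hk).2 ha ham
        rwa [← msg_congr (AgentAction.token_injective (ha.trans this.symm))]
    · obtain ⟨h1, h2⟩ := hsil k hk j
      rw [h1, h2]
  intro s hs
  rcases Nat.lt_or_ge s t with hst | hst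
  · exact h s hst
  obtain rfl : s = t := by omega
  refine ⟨fun j hj => AgentAction.token_injective (Option.ext fun a => ?_), hsil⟩
  exact ⟨token_transfer hG hG' hT hT' (fun a => (hpred j hj a).1) (h.hasIncoming_iff hj).1
      (fun u σ => (hmsg u j σ).2),
    token_transfer hG' hG hT' hT (fun a => (hpred j hj a).2) (h.hasIncoming_iff hj).2
      (fun u σ => (hmsg u j σ).1)⟩

theorem LastCot.unique_of_act_eq {i : Fin w} {σ τ : Ξ} (h : G.LastCot i σ) (h' : G'.LastCot i τ)
    (hact : ∀ t, G.act i t = G'.act i t) : σ = τ := by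
  obtain ⟨t, ht, hlast⟩ := h
  obtain ⟨t', ht', hlast'⟩ := h'
  rw [← hact] at ht'
  rcases lt_trichotomy t t' with hlt | rfl | hlt
  · exact absurd ⟨τ, ht'⟩ (hlast t' hlt)
  · rw [ht] at ht'
    injection ht'
  · exact absurd ⟨σ, by rw [← hact]; exact ht⟩ (hlast' t hlt)

end CommGraph

/-! ### Input chunks and products -/

theorem chunk_congr {M : Type*} {N w i : ℕ} {x x' : Fin N → M}
    (h : ∀ p : Fin N, (N * i) ⌈/⌉ w ≤ p → (p : ℕ) < (N * (i + 1)) ⌈/⌉ w → x p = x' p) :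
    chunk x w i = chunk x' w i := by
  unfold chunk
  refine List.ext_getElem (by simp) fun k h1 h2 => ?_
  simp only [List.length_drop, List.length_take, List.length_ofFn] at h1
  simp only [List.getElem_drop, List.getElem_take, List.getElem_ofFn]
  exact h _ (by simp) (by simp; omega)

theorem ceilDiv_mono {a b w : ℕ} (hw : 0 < w) (h : a ≤ b) : a ⌈/⌉ w ≤ b ⌈/⌉ w := by
  rw [ceilDiv_le_iff_le_mul hw]
  exact h.trans (by simpa using le_smul_ceilDiv hw (b := b))

theorem chunk_zero {M : Type*} {N w : ℕ} (x : Fin N → M) :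
    chunk x w 0 = (List.ofFn x).take (N ⌈/⌉ w) := by
  simp [chunk]

theorem eq_of_prod_update_eq {M : Type*} [Group M] {N : ℕ} {x : Fin N → M} {p : Fin N} {a : M}
    (h : (List.ofFn (Function.update x p a)).prod = (List.ofFn x).prod) : a = x p := by
  have hset : ∀ b, List.ofFn (Function.update x p b) = (List.ofFn x).set p b := by
    intro b
    refine List.ext_getElem (by simp) fun k h1 h2 => ?_
    simp only [List.getElem_ofFn, List.getElem_set, Function.update_apply, Fin.ext_iff]
    simp only [eq_comm]
  have hx := hset (x p)
  rw [Function.update_eq_self] at hx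
  rw [hset] at h
  nth_rewrite 2 [hx] at h
  rw [List.prod_set, List.prod_set, mul_left_inj, mul_right_inj] at h
  simpa only [List.length_ofFn, p.2, if_true] using h

/-! ### Feeding tokens to a restricted transformer -/

section Feed

variable {ι M α : Type*}

/-- On the words of `C`, whose first `n` tokens are given by `s`, the activations of `T` at the
positions of the input depend on one letter each, and the activations at the positions of the
continuation `u` are constant. -/
def Settled (C : Set (ι → M)) (n : ℕ) (T : UHAT α) (s : (ι → M) → List α) (u : List α) : Prop :=
  AllSingle C n T.hardLayers (fun x => T.input (s x ++ u)) ∧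
    ∀ k, n ≤ k → k < n + u.length → Frozen C k T.hardLayers fun x => T.input (s x ++ u)

variable {C : Set (ι → M)} {n H : ℕ} {T : UHAT α} {s : (ι → M) → List α} {u : List α}

/-- The prediction is made at the last position, which lies in the continuation. -/
theorem Settled.predicts_iff (h : Settled C n T s u) (hs : ∀ x, (s x).length = n) (hu : u ≠ [])
    {x x' : ι → M} (hx : x ∈ C) (hx' : x' ∈ C) (a : α) :
    T.Predicts (s x ++ u) a ↔ T.Predicts (s x' ++ u) a := by
  have hpos : 0 < u.length := List.length_pos_of_ne_nil hu
  rw [UHAT.Predicts.iff_decode_evalList (by simp [hu]),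
    UHAT.Predicts.iff_decode_evalList (by simp [hu]), List.length_append, List.length_append, hs,
    hs]
  have e := (h.2 (n + u.length - 1) (by omega) (by omega)).evalList x hx x' hx' (by simp)
  simp only at e
  rw [e]

variable [DecidableEq ι] [Finite ι] [Finite M] {F : Finset ι} {y : ι → M}

/-- The new position is frozen by `exists_cube_frozen`, and causality preserves what is known about
the earlier positions. -/
theorem Settled.exists_cube_append_singleton (h : Settled (cube F y) n T s u)
    (hs : ∀ x, (s x).length = n) (hH : ∀ l ∈ T.hardLayers, l.heads ≤ H) (a : α) :
    ∃ F' ⊆ F, ∃ y' ∈ cube F y, F.card ≤ F'.card + T.hardLayers.length * H ∧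
      Settled (cube F' y') n T s (u ++ [a]) := by
  have hin : ∀ x ∈ cube F y, ∀ k < n + u.length,
      T.input (s x ++ u) k = T.input (s x ++ (u ++ [a])) k := by
    intro x _ k hk
    rw [← List.append_assoc]
    exact (T.input_append_of_lt (by rw [List.length_append, hs]; exact hk)).symm
  have h1 : AllSingle (cube F y) n T.hardLayers fun x => T.input (s x ++ (u ++ [a])) :=
    h.1.congr fun x hx p hp => hin x hx p (by omega)
  have h2 : ∀ k, n ≤ k → k < n + u.length →
      Frozen (cube F y) k T.hardLayers fun x => T.input (s x ++ (u ++ [a])) :=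
    fun k hk hk' => (h.2 k hk hk').congr fun x hx j hj => hin x hx j (by omega)
  obtain ⟨F', hF', y', hy', hcard, hfr⟩ := exists_cube_frozen (p := n + u.length) (by omega)
    T.hardLayers hH h1 h2 (by
      intro x _ x' _ _
      simp only [UHAT.input, List.length_append, hs, List.length_singleton]
      rw [dif_pos (by omega), dif_pos (by omega)]
      congr 2
      simp [hs])
  have hsub := cube_subset_cube hF' hy'
  refine ⟨F', hF', y', hy', hcard, h1.mono hsub, fun k hk hk' => ?_⟩
  rcases Nat.lt_or_ge k (n + u.length) with hlt | hge
  · exact (h2 k hk hlt).mono hsub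
  · rw [List.length_append, List.length_singleton] at hk'
    obtain rfl : k = n + u.length := by omega
    exact hfr

/-- Each further token costs a bounded number of free letters. -/
theorem Settled.exists_cube_append (h : Settled (cube F y) n T s u)
    (hs : ∀ x, (s x).length = n) (hH : ∀ l ∈ T.hardLayers, l.heads ≤ H) (v : List α) :
    ∃ F' ⊆ F, ∃ y' ∈ cube F y, F.card ≤ F'.card + v.length * (T.hardLayers.length * H) ∧
      Settled (cube F' y') n T s (u ++ v) := by
  induction v generalizing u F y with
  | nil => exact ⟨F, le_rfl, y, base_mem_cube F y, by simp, by simpa using h⟩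
  | cons a v ih =>
    obtain ⟨F₁, hF₁, y₁, hy₁, hc₁, h₁⟩ := h.exists_cube_append_singleton hs hH a
    obtain ⟨F₂, hF₂, y₂, hy₂, hc₂, h₂⟩ := ih h₁
    refine ⟨F₂, hF₂.trans hF₁, y₂, cube_subset_cube hF₁ hy₁ hy₂, ?_, by simpa using h₂⟩
    rw [List.length_cons, add_mul]
    omega

end Feed

/-! ### State tracking -/

namespace MultiAgentSystem

variable {M Ξ : Type*} {A : MultiAgentSystem M Ξ}

/-- If the manager acts in the same way on two words, then they have the same product. -/
theorem Computes.prod_eq [Group M] (hcomp : A.Computes (stateTracking M)) {N : ℕ} (hN : 1 ≤ N)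
    {x x' : Fin N → M}
    (h : ∀ t, (A.graph N x).act (A.manager N hN) t = (A.graph N x').act (A.manager N hN) t) :
    (List.ofFn x).prod = (List.ofFn x').prod :=
  A.incl.injective ((hcomp N hN x).unique_of_act_eq (hcomp N hN x') h)

/-- An agent other than the manager that holds the letter `p` cannot remain silent for two values of
this letter: nobody else would notice the difference. -/
theorem sends_or_sends [Group M] (hcomp : A.Computes (stateTracking M)) {N : ℕ} (hN : 1 ≤ N)
    {T : UHAT (Token Ξ)} (hT : ∀ x : Fin N → M,
      (A.graph N x).ImplementedBy (fun i => (chunk x (A.w N) i).map A.incl) T)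
    {i : Fin (A.w N)} (hi : i ≠ A.manager N hN) {p : Fin N}
    (hp : (N * i) ⌈/⌉ A.w N ≤ p) (hp' : (p : ℕ) < (N * (i + 1)) ⌈/⌉ A.w N) (x : Fin N → M) {a : M}
    (ha : a ≠ x p) :
    (A.graph N x).Sends i ∨ (A.graph N (Function.update x p a)).Sends i := by
  by_contra hn
  rw [not_or] at hn
  set x' := Function.update x p a with hx'
  have hw : 0 < A.w N := A.w_pos N hN
  have hsil : ∀ t, ∀ k, k ∉ {k : Fin (A.w N) | k ≠ i} → ∀ j,
      (A.graph N x).msg k t j = none ∧ (A.graph N x').msg k t j = none := by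
    intro t k hk j
    obtain rfl : k = i := by simpa using hk
    exact ⟨Option.eq_none_iff_forall_ne_some.2 fun σ hσ => hn.1 ⟨t, j, σ, hσ⟩,
      Option.eq_none_iff_forall_ne_some.2 fun σ hσ => hn.2 ⟨t, j, σ, hσ⟩⟩
  have hchunk : ∀ j : Fin (A.w N), j ≠ i → chunk x (A.w N) j = chunk x' (A.w N) j := by
    intro j hj
    refine chunk_congr fun k hk hk' => ?_
    rw [hx', Function.update_of_ne]
    rintro rfl
    rcases lt_or_gt_of_ne (Fin.val_ne_of_ne hj) with h | h
    · have := ceilDiv_mono hw (Nat.mul_le_mul_left N (show (j : ℕ) + 1 ≤ i from h))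
      omega
    · have := ceilDiv_mono hw (Nat.mul_le_mul_left N (show (i : ℕ) + 1 ≤ j from h))
      omega
  have hagree : ∀ t, CommGraph.AgreeBefore (A.graph N x) (A.graph N x') {k | k ≠ i} t := by
    intro t
    induction t with
    | zero => exact fun s hs => absurd hs (Nat.not_lt_zero s)
    | succ t ih =>
      refine ih.succ (A.wellFormed N hN x) (A.wellFormed N hN x') (hT x) (hT x') (hsil t) ?_
      intro j hj b
      simp only [hchunk j hj]
      rw [ih.contextAt_eq hj]
  refine ha (eq_of_prod_update_eq ?_)
  exact (hcomp.prod_eq hN fun t => (hagree (t + 1) t (Nat.lt_succ_self t)).1 _ hi.symm).symm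

theorem graph_commBudget_le [Fintype M] (A : MultiAgentSystem M Ξ) {N : ℕ} (x : Fin N → M) :
    (A.graph N x).commBudget ≤ A.commBudget N :=
  Finset.le_sup (f := fun x : Fin N → M => (A.graph N x).commBudget) (Finset.mem_univ x)

theorem graph_depth_le [Fintype M] (A : MultiAgentSystem M Ξ) {N : ℕ} (hN : 1 ≤ N)
    (x : Fin N → M) : (A.graph N x).depth ≤ A.depth N :=
  (Finset.le_sup (f := fun x : Fin N → M => (A.graph N x).depth) (Finset.mem_univ x)).trans
    (Finset.le_sup (f := fun n => Finset.univ.sup fun x : Fin n → M => (A.graph n x).depth)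
      (Finset.mem_Icc.2 ⟨hN, le_rfl⟩))

/-- On average over all words, at least half of the agents other than the manager send a message. -/
theorem w_le_four_mul_commBudget [Group M] [Fintype M] [Nontrivial M]
    (hexp : A.ExpressibleInUHAT) (hcomp : A.Computes (stateTracking M)) {N : ℕ} (hN : 1 ≤ N)
    (hw2 : 2 ≤ A.w N) :
    A.w N ≤ 4 * A.commBudget N := by
  classical
  obtain ⟨-, -, T, -, hT⟩ := hexp
  obtain ⟨g, hg⟩ := exists_ne (1 : M)
  have hw : 0 < A.w N := A.w_pos N hN
  set m := A.manager N hN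
  have hhalf : ∀ i ∈ Finset.univ.erase m, Fintype.card (Fin N → M) ≤
      2 * (Finset.univ.filter fun x : Fin N → M => (A.graph N x).Sends i).card := by
    intro i hi
    have hlt : (N * i) ⌈/⌉ A.w N < (N * (i + 1)) ⌈/⌉ A.w N := by
      by_contra hn
      rw [not_lt, ceilDiv_le_iff_le_mul hw] at hn
      have h1 : A.w N * ((N * i) ⌈/⌉ A.w N) < N * i + A.w N := by
        rw [Nat.ceilDiv_eq_add_pred_div]
        have := Nat.mul_div_le (N * i + A.w N - 1) (A.w N)
        omega
      have h2 := A.w_le N hN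
      rw [mul_add] at hn
      omega
    have hltN : (N * i) ⌈/⌉ A.w N < N := by
      refine hlt.trans_le ?_
      rw [ceilDiv_le_iff_le_mul hw, mul_comm N]
      exact Nat.mul_le_mul_right N i.2
    let p : Fin N := ⟨(N * i) ⌈/⌉ A.w N, hltN⟩
    let τ : (Fin N → M) → (Fin N → M) := fun x => x * Pi.mulSingle p g
    have hτ : ∀ x, τ x = Function.update x p (x p * g) := by
      intro x
      funext j
      by_cases hj : j = p
      · subst hj; simp [τ]
      · simp [τ, hj]
    set S := Finset.univ.filter fun x : Fin N → M => (A.graph N x).Sends i with hS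
    have hcover : (Finset.univ : Finset (Fin N → M)) ⊆ S ∪ Finset.univ.filter fun x => τ x ∈ S := by
      intro x _
      have := sends_or_sends hcomp hN (hT N N hN le_rfl) (Finset.ne_of_mem_erase hi) (p := p)
        le_rfl hlt x (a := x p * g) (by simpa using hg)
      rw [← hτ] at this
      simpa [hS] using this
    have hcard : (Finset.univ.filter fun x => τ x ∈ S).card ≤ S.card :=
      Finset.card_le_card_of_injOn τ (fun x hx => by simpa using hx)
        ((mul_left_injective _).injOn)
    have := (Finset.card_le_card hcover).trans (Finset.card_union_le _ _)
    rw [Finset.card_univ] at this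
    omega
  have hsum : (A.w N - 1) * Fintype.card (Fin N → M) ≤
      2 * (Fintype.card (Fin N → M) * A.commBudget N) := by
    calc (A.w N - 1) * Fintype.card (Fin N → M)
        = ∑ i ∈ Finset.univ.erase m, Fintype.card (Fin N → M) := by
          rw [Finset.sum_const, Finset.card_erase_of_mem (Finset.mem_univ m)]
          simp
      _ ≤ ∑ i ∈ Finset.univ.erase m,
            2 * (Finset.univ.filter fun x : Fin N → M => (A.graph N x).Sends i).card :=
          Finset.sum_le_sum hhalf
      _ ≤ ∑ i, 2 * (Finset.univ.filter fun x : Fin N → M => (A.graph N x).Sends i).card :=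
          Finset.sum_le_sum_of_subset (Finset.erase_subset _ _)
      _ = 2 * ∑ x : Fin N → M, (Finset.univ.filter fun i => (A.graph N x).Sends i).card := by
          rw [← Finset.mul_sum]
          simp only [Finset.card_filter]
          rw [Finset.sum_comm]
      _ ≤ 2 * ∑ x : Fin N → M, A.commBudget N := by
          refine Nat.mul_le_mul_left _ (Finset.sum_le_sum fun x _ => ?_)
          refine le_trans ?_ (((A.wellFormed N hN x).ncard_sends_le).trans
            (A.graph_commBudget_le x))
          rw [← Set.ncard_coe_finset]
          simp
      _ = 2 * (Fintype.card (Fin N → M) * A.commBudget N) := by simp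
  have hpos : 0 < Fintype.card (Fin N → M) := Fintype.card_pos
  have : A.w N - 1 ≤ 2 * A.commBudget N := by
    refine Nat.le_of_mul_le_mul_right (hsum.trans (le_of_eq ?_)) hpos
    ring
  omega

/-- Token by token, the computation can be frozen on a subcube of the inputs: the cost in free
letters is bounded by the number of tokens of the first agent. -/
theorem exists_cube_agreeBefore [Finite M] {N n H : ℕ} (hN : 1 ≤ N) {T : UHAT (Token Ξ)}
    (hT : ∀ x : Fin N → M,
      (A.graph N x).ImplementedBy (fun i => (chunk x (A.w N) i).map A.incl) T)
    (hH : ∀ l ∈ T.hardLayers, l.heads ≤ H)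
    (hn : ∀ x : Fin N → M, (chunk x (A.w N) 0).length = n)
    {F : Finset (Fin N)} {y : Fin N → M}
    (hother : ∀ x ∈ cube F y, ∀ x' ∈ cube F y, ∀ j : Fin (A.w N), (j : ℕ) ≠ 0 →
      chunk x (A.w N) j = chunk x' (A.w N) j)
    (hset : Settled (cube F y) n T (fun x => ((chunk x (A.w N) 0).map A.incl).map Token.sym) [])
    (t : ℕ) :
    ∃ F' ⊆ F, ∃ y' ∈ cube F y,
      F.card ≤ F'.card + (2 * t + 1) * (T.hardLayers.length * H) ∧
      (∀ x ∈ cube F' y', ∀ x' ∈ cube F' y',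
        CommGraph.AgreeBefore (A.graph N x) (A.graph N x') Set.univ t) ∧
      Settled (cube F' y') n T (fun x => ((chunk x (A.w N) 0).map A.incl).map Token.sym)
        ((A.graph N y').trace ⟨0, A.w_pos N hN⟩ t) := by
  set s : (Fin N → M) → List (Token Ξ) := fun x => ((chunk x (A.w N) 0).map A.incl).map Token.sym
    with hsdef
  have hs : ∀ x, (s x).length = n := fun x => by simp [hsdef, hn]
  set i₀ : Fin (A.w N) := ⟨0, A.w_pos N hN⟩ with hi₀
  induction t with
  | zero =>
    obtain ⟨F', hF', y', hy', hc, h⟩ := hset.exists_cube_append hs hH [Token.ident 0]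
    refine ⟨F', hF', y', hy', by simpa using hc,
      fun x _ x' _ s hs => absurd hs (Nat.not_lt_zero s), ?_⟩
    simpa [CommGraph.trace, hi₀] using h
  | succ t ih =>
    obtain ⟨F₁, hF₁, y₁, hy₁, hc₁, hagree, h₁⟩ := ih
    obtain ⟨F₂, hF₂, y₂, hy₂, hc₂, h₂⟩ := h₁.exists_cube_append hs hH
      ((A.graph N y₁).recvTokens i₀ t)
    have hsub₂ := cube_subset_cube hF₂ hy₂
    have hsub₁ := cube_subset_cube hF₁ hy₁
    have hctx : ∀ x ∈ cube F₂ y₂,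
        (A.graph N x).contextAt ((chunk x (A.w N) 0).map A.incl) i₀ t =
          s x ++ ((A.graph N y₁).trace i₀ t ++ (A.graph N y₁).recvTokens i₀ t) := by
      intro x hx
      have h := hagree x (hsub₂ hx) y₁ (base_mem_cube _ _)
      rw [CommGraph.contextAt, CommGraph.history_eq_append_trace,
        h.trace_eq (Set.mem_univ _) le_rfl, h.recvTokens_eq le_rfl, List.append_assoc]
    have hagree' : ∀ x ∈ cube F₂ y₂, ∀ x' ∈ cube F₂ y₂,
        CommGraph.AgreeBefore (A.graph N x) (A.graph N x') Set.univ (t + 1) := by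
      intro x hx x' hx'
      have h := hagree x (hsub₂ hx) x' (hsub₂ hx')
      refine h.succ (A.wellFormed N hN x) (A.wellFormed N hN x') (hT x) (hT x')
        (fun k hk => absurd (Set.mem_univ k) hk) fun j _ a => ?_
      by_cases hj : (j : ℕ) = 0
      · obtain rfl : j = i₀ := Fin.ext hj
        have e : ((i₀ : Fin (A.w N)) : ℕ) = 0 := rfl
        simp only [e]
        rw [hctx x hx, hctx x' hx']
        exact h₂.predicts_iff hs (by simp [CommGraph.trace]) hx hx' a
      · simp only [hother x (hsub₁ (hsub₂ hx)) x' (hsub₁ (hsub₂ hx')) j hj]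
        rw [h.contextAt_eq (Set.mem_univ j)]
    obtain ⟨F₃, hF₃, y₃, hy₃, hc₃, h₃⟩ := h₂.exists_cube_append hs hH
      ((A.graph N y₂).outTokens i₀ t)
    have hsub₃ := cube_subset_cube hF₃ hy₃
    refine ⟨F₃, hF₃.trans (hF₂.trans hF₁), y₃, hsub₁ (hsub₂ hy₃), ?_,
      fun x hx x' hx' => hagree' x (hsub₃ hx) x' (hsub₃ hx'), ?_⟩
    · have h1 := Nat.mul_le_mul_right (T.hardLayers.length * H)
        ((A.wellFormed N hN y₁).length_recvTokens_le i₀ t)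
      have h2 := Nat.mul_le_mul_right (T.hardLayers.length * H)
        ((A.graph N y₂).length_outTokens_le i₀ t)
      have h3 : (2 * (t + 1) + 1) * (T.hardLayers.length * H) =
        (2 * t + 1) * (T.hardLayers.length * H) + 1 * (T.hardLayers.length * H) +
          1 * (T.hardLayers.length * H) := by ring
      omega
    · have e1 := (hagree' y₃ hy₃ y₂ (base_mem_cube _ _)).trace_eq (Set.mem_univ i₀) le_rfl
      have e2 := hagree y₂ hy₂ y₁ (base_mem_cube _ _)
      rw [e1, CommGraph.trace_succ, e2.trace_eq (Set.mem_univ i₀) le_rfl, e2.recvTokens_eq le_rfl]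
      exact h₃

/-- The chunk of the first agent is at most a constant factor longer than the depth. -/
theorem exists_ceilDiv_le_mul_depth [Group M] [Fintype M] [Nontrivial M]
    (hexp : A.ExpressibleInUHAT) (hcomp : A.Computes (stateTracking M)) :
    ∃ K : ℕ, ∀ N, 1 ≤ N → N ⌈/⌉ A.w N ≤ K * A.depth N := by
  classical
  obtain ⟨L, H, T, hLH, hT⟩ := hexp
  obtain ⟨K, hK⟩ := exists_cube_allSingle H (Fintype.card M) L 1
  refine ⟨K * (5 * (L * H)), fun N hN => ?_⟩
  have hw : 0 < A.w N := A.w_pos N hN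
  -- Only the letters of the first chunk are varied; the other letters are set to `1`.
  set n := N ⌈/⌉ A.w N with hn
  set D := A.depth N with hD
  have hnN : n ≤ N := by
    rw [hn, ceilDiv_le_iff_le_mul hw]
    exact Nat.le_mul_of_pos_left N hw
  have hlayers : (T N).hardLayers.length ≤ L := by simpa [UHAT.hardLayers] using (hLH N).1
  have hheads : ∀ l ∈ (T N).hardLayers, l.heads ≤ H := by
    intro l hl
    obtain ⟨l', hl', rfl⟩ := List.mem_map.1 hl
    exact (hLH N).2 l' hl'
  let F₀ : Finset (Fin N) := Finset.univ.filter fun p => (p : ℕ) < n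
  have hF₀ : F₀.card = n := by
    simp only [F₀]
    rw [Fin.card_filter_val_lt]
    omega
  let s : (Fin N → M) → List (Token Ξ) := fun x =>
    ((chunk x (A.w N) 0).map A.incl).map Token.sym
  have hchunk : ∀ x : Fin N → M, (chunk x (A.w N) 0).length = n := by
    intro x
    rw [chunk_zero, List.length_take, List.length_ofFn]
    omega
  have hsingle : Single (cube F₀ (1 : Fin N → M)) n fun x => (T N).input (s x ++ []) := by
    refine ⟨fun p => if hp : p < N then ⟨p, hp⟩ else ⟨0, hN⟩, fun p hp x _ x' _ hxx => ?_⟩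
    have hlen : ∀ x, p < (s x ++ []).length := fun x => by simpa [s, hchunk] using hp
    have hxp : x ⟨p, hp.trans_le hnN⟩ = x' ⟨p, hp.trans_le hnN⟩ := by
      simpa [hp.trans_le hnN] using hxx
    simp only [UHAT.input, dif_pos (hlen _)]
    congr 2
    simp [s, chunk_zero, hxp]
  obtain ⟨F₁, hF₁, y₁, hy₁, hn₁, h₁⟩ := hK rfl (T N).hardLayers hlayers hheads n F₀ 1
    (by rw [hF₀, one_mul]) _ hsingle
  have hsub₁ := cube_subset_cube hF₁ hy₁
  obtain ⟨F₂, hF₂, y₂, hy₂, hc₂, hagree, -⟩ := exists_cube_agreeBefore (A := A) hN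
    (hT N N hN le_rfl) hheads hchunk (F := F₁) (y := y₁) (by
      intro x hx x' hx' j hj
      refine chunk_congr fun p hp _ => eq_of_mem_cube (hsub₁ hx) (hsub₁ hx') ?_
      have : n ≤ (N * j) ⌈/⌉ A.w N :=
        ceilDiv_mono hw (Nat.le_mul_of_pos_right N (Nat.pos_of_ne_zero hj))
      simp only [F₀, Finset.mem_filter, not_and, not_lt]
      exact fun _ => this.trans hp)
    ⟨h₁, fun k hk hk' => absurd hk' (by simpa using hk)⟩ (D + 1)
  have hlen : ∀ (x : Fin N → M) j, (A.graph N x).len j ≤ D + 1 := fun x j =>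
    ((A.wellFormed N hN x).len_le_depth_add_one j).trans
      (Nat.add_le_add_right (A.graph_depth_le hN x) 1)
  -- A remaining free letter could be changed without any effect on the graph.
  have hempty : F₂ = ∅ := by
    rw [Finset.eq_empty_iff_forall_notMem]
    intro p hp
    obtain ⟨a, ha⟩ := exists_ne (y₂ p)
    refine ha (eq_of_prod_update_eq (hcomp.prod_eq hN fun t => ?_))
    rcases Nat.lt_or_ge t (D + 1) with ht | ht
    · exact (hagree _ (update_mem_cube (base_mem_cube _ _) hp a) y₂ (base_mem_cube _ _) t ht).1 _
        (Set.mem_univ _)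
    · rw [(A.wellFormed N hN _).act_eq_none _ t ((hlen _ _).trans ht),
        (A.wellFormed N hN _).act_eq_none _ t ((hlen _ _).trans ht)]
  have hD1 : 1 ≤ D := ((A.wellFormed N hN 1).one_le_depth (hcomp N hN 1)).trans
    (A.graph_depth_le hN 1)
  rw [hempty, Finset.card_empty, zero_add] at hc₂
  calc n ≤ K * F₁.card := hn₁
    _ ≤ K * ((5 * D) * (L * H)) := by
      refine Nat.mul_le_mul_left _ (hc₂.trans ?_)
      exact Nat.mul_le_mul (by omega) (Nat.mul_le_mul_right _ hlayers)
    _ = K * (5 * (L * H)) * D := by ring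

end MultiAgentSystem

theorem mainTheorem3 {M Ξ : Type*} [Group M] [Fintype M] [Nontrivial M]
    (A : MultiAgentSystem M Ξ) (hexp : A.ExpressibleInUHAT)
    (hcomp : A.Computes (stateTracking M)) :
    ∃ c : ℝ, 0 < c ∧ ∀ N : ℕ, 1 ≤ N →
      (2 ≤ A.w N → c * (A.w N : ℝ) ≤ (A.commBudget N : ℝ)) ∧
      c * ((N : ℝ) / (A.w N : ℝ)) ≤ (A.depth N : ℝ) := by
  obtain ⟨K, hK⟩ := MultiAgentSystem.exists_ceilDiv_le_mul_depth hexp hcomp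
  refine ⟨1 / ((K : ℝ) + 4), by positivity, fun N hN => ⟨fun hw2 => ?_, ?_⟩⟩
  · have h1 : (A.w N : ℝ) ≤ 4 * A.commBudget N := by
      exact_mod_cast MultiAgentSystem.w_le_four_mul_commBudget hexp hcomp hN hw2
    have h2 : (0 : ℝ) ≤ K * A.commBudget N := by positivity
    rw [one_div_mul_eq_div, div_le_iff₀ (by positivity)]
    linarith
  · have hw : 0 < A.w N := A.w_pos N hN
    have h1 : (N : ℝ) ≤ A.w N * ((N ⌈/⌉ A.w N : ℕ) : ℝ) := by
      exact_mod_cast (by simpa using le_smul_ceilDiv hw (b := N) : N ≤ A.w N * (N ⌈/⌉ A.w N))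
    have h2 : ((N ⌈/⌉ A.w N : ℕ) : ℝ) ≤ K * A.depth N := by exact_mod_cast hK N hN
    have h3 : (N : ℝ) / A.w N ≤ K * A.depth N := by
      rw [div_le_iff₀ (by exact_mod_cast hw)]
      calc (N : ℝ) ≤ A.w N * ((N ⌈/⌉ A.w N : ℕ) : ℝ) := h1
        _ ≤ A.w N * (K * A.depth N) := by gcongr
        _ = _ := mul_comm _ _
    have h4 : (0 : ℝ) ≤ A.depth N := by positivity
    rw [one_div_mul_eq_div, div_le_iff₀ (by positivity)]
    linarith
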